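/- **Setting.** Let $G$ be a simple undirected graph on $[n]=\{1,\dots,n\}$ that is connected and not bipartite, with adjacency matrix $A$ and degree matrix $B$. Let $M_{ij}=A_{ij}/\deg(i)$, let $P(t)=(M^T)^tP(0)$ be the position distribution after $t$ steps of the random walk, for any initial probability vector $P(0)$, and let $\pi$ be the stationary distribution, $\pi=M^T\pi$. Let $\alpha_1\ge\dots\ge\alpha_n$ be the eigenvalues of $B^{-1/2}AB^{-1/2}$ (equivalently, of $M$) and $\alpha=\min(1-\alpha_2,\,1-|\alpha_n|)$. For $k\in[n]$ let $\mathcal A^{(k)}:\mathcal S^{(1)}\times\cdots\times\mathcal S^{(k-1)}\times\mathcal D\to\mathcal S^{(k)}$ be randomized maps, where $\mathcal S^{(1)},\dots,\mathcal S^{(n)}$ are measurable spaces. The family is called $(\varepsilon_0,\delta_0)$-DP if for every $k$, every $s_{1:k-1}$, all $x,x'\in\mathcal D$ and every measurable $E$, $$\Pr[\mathcal A^{(k)}(s_{1:k-1};x)\in E]\le e^{\varepsilon_0}\Pr[\mathcal A^{(k)}(s_{1:k-1};x')\in E]+\delta_0 ,$$ and $\varepsilon_0$-DP if this holds with $\delta_0=0$.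 Let $\ell=(\ell_1,\dots,\ell_n)$ be nonnegative integers with $\sum_i\ell_i=n$. The mechanism $\mathcal A_{fix}(x_{1:n},\ell)$ draws successively $s_k\leftarrow\mathcal A^{(k)}(s_{1:k-1};x_k)$ for $k=1,\dots,n$ and returns $(S_1,\dots,S_n)$, where $S_i$ consists of the reports $s_k$, recorded with their indices, for $\ell_1+\dots+\ell_{i-1}<k\le\ell_1+\dots+\ell_i$. For a dataset $D=(x_1,\dots,x_n)\in\mathcal D^n$ let $\sigma(D)$ be $D$ with $x_1$ and $x_I$ swapped, $I$ uniform on $[n]$. A mechanism $\mathcal M$ is $(\varepsilon,\delta)$-DP at index $1$ if $\Pr[\mathcal M(D)\in E]\le e^{\varepsilon}\Pr[\mathcal M(D')\in E]+\delta$ for all $D,D'$ that differ at most in the first element and all measurable $E$. **Theorem.** Let $\varepsilon_0\ge0$, $\delta,\delta_2\in(0,1)$, $t\in\{0,1,2,\dots\}$, let $q$ be either of the two numbers $$\sum_{i}P_i(t)^2,\qquad \sum_i\pi_i^2+(1-\alpha)^{2t},$$ and put $$\varepsilon_1=\sqrt{\left(1-\tfrac1n\right)q}+\sqrt{\frac{\log(1/\delta_2)}{n}},\qquad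 \varepsilon(a)=\frac{(e^{a}-1)^2e^{4a}\varepsilon_1^2}{2}+\varepsilon_1\sqrt{2(e^{a}-1)^2e^{4a}\log\frac1\delta}.$$ 1. If the family $\mathcal A^{(1)},\dots,\mathcal A^{(n)}$ is $\varepsilon_0$-DP, then $D\mapsto\mathcal A_{fix}(\sigma(D),\ell)$ is $(\varepsilon(\varepsilon_0),\,\delta+\delta_2)$-DP at index $1$. 2. If $\varepsilon_0>0$, $\delta_1>0$ and the family is $(\varepsilon_0,\delta_0)$-DP with $$0\le\delta_0\le\frac{(1-e^{-\varepsilon_0})\,\delta_1}{4e^{\varepsilon_0}\left(2+\frac{\ln(2/\delta_1)}{\ln(1/(1-e^{-5\varepsilon_0}))}\right)},$$ then $D\mapsto\mathcal A_{fix}(\sigma(D),\ell)$ is $(\varepsilon',\delta')$-DP at index $1$ with $\varepsilon'=\varepsilon(8\varepsilon_0)$ and $\delta'=\delta+\delta_2+n(e^{\varepsilon'}+1)\delta_1$. 3. If $G$ is regular, then $\sum_iP_i(t)^2\le\sum_i\pi_i^2+(1-\alpha)^{2t}$. For every $G$ as above, $\sum_iP_i(t)^2/\pi_i\le1+(1-\alpha)^{2t}\sum_iP_i(0)^2/\pi_i$.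 -/

import Mathlib

open MeasureTheory ProbabilityTheory
open scoped Matrix

/-! ### Differential privacy -/

/-- `μ(E) ≤ e^ε ν(E) + δ` for every measurable set `E` of outputs. -/
def DPClose {Ω : Type*} [MeasurableSpace Ω] (ε δ : ℝ) (μ ν : Measure Ω) : Prop :=
  ∀ E : Set Ω, MeasurableSet E → μ.real E ≤ Real.exp ε * ν.real E + δ

/-- A randomized map on single data elements (given by its output laws) is an `(ε, δ)`-DP local
randomizer: the output laws at any two inputs are `(ε, δ)`-indistinguishable. -/
def IsLocalDP {X Ω : Type*} [MeasurableSpace Ω] (ε δ : ℝ) (R : X → Measure Ω) : Prop :=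
  ∀ x x' : X, DPClose ε δ (R x) (R x')

/-- A mechanism on datasets of `n` elements is `(ε, δ)`-DP at the first index: the condition of
`(ε, δ)`-differential privacy for any two datasets that agree outside the first element. -/
def IsDPAtFirst {n : ℕ} [NeZero n] {X Ω : Type*} [MeasurableSpace Ω] (ε δ : ℝ)
    (M : (Fin n → X) → Measure Ω) : Prop :=
  ∀ D D' : Fin n → X, (∀ i, i ≠ 0 → D i = D' i) → DPClose ε δ (M D) (M D')

/-! ### Local responses with fixed report sizes -/

/-- The space `S⁽¹⁾ × ⋯ × S⁽ᵏ⁾` of the first `k` reports. -/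
abbrev ReportPrefix {n : ℕ} (S : Fin n → Type*) (k : ℕ) (hk : k ≤ n) : Type _ :=
  ∀ j : Fin k, S (j.castLE hk)

/-- A family of adaptive randomizers
`A⁽ᵏ⁾ : S⁽¹⁾ × ⋯ × S⁽ᵏ⁻¹⁾ × X → S⁽ᵏ⁾`: the `k`-th report is drawn from a law that depends on the
earlier reports and on one data element. -/
abbrev AdaptiveRandomizers {n : ℕ} (X : Type*) (S : Fin n → Type*)
    [∀ k, MeasurableSpace (S k)] : Type _ :=
  ∀ k : Fin n, X → Kernel (ReportPrefix S k k.isLt.le) (S k)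

/-- The family consists of `(ε, δ)`-DP local randomizers: this holds for every report index and all
values of the earlier reports. -/
def IsLocalDPFamily {n : ℕ} {X : Type*} {S : Fin n → Type*} [∀ k, MeasurableSpace (S k)]
    (ε δ : ℝ) (A : AdaptiveRandomizers X S) : Prop :=
  ∀ (k : Fin n) (s : ReportPrefix S k k.isLt.le), IsLocalDP ε δ (fun x => A k x s)

/-- The joint law of the first `k` reports on the dataset `x`, where successively
`s_k ← A⁽ᵏ⁾(s_1, …, s_{k-1}; x_k)`. -/
noncomputable def reportLaw {n : ℕ} {X : Type*} {S : Fin n → Type*} [∀ k, MeasurableSpace (S k)]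
    (A : AdaptiveRandomizers X S) (x : Fin n → X) :
    (k : ℕ) → (hk : k ≤ n) → Measure (ReportPrefix S k hk)
  | 0, _ => Measure.dirac (fun j => j.elim0)
  | k + 1, hk =>
      (reportLaw A x k (Nat.le_of_succ_le hk) ⊗ₘ A ⟨k, hk⟩ (x ⟨k, hk⟩)).map
        (fun p => Fin.snoc (α := fun j : Fin (k + 1) => S (j.castLE hk)) p.1 p.2)

/-- The indices of the reports held by user `i` when the reports are handed out in order,
`ℓ 0` of them to the first user, the next `ℓ 1` to the second user, and so on. -/
abbrev Block {n : ℕ} (ℓ : Fin n → ℕ) (i : Fin n) : Type :=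
  {k : Fin n // ∑ j ∈ Finset.Iio i, ℓ j ≤ (k : ℕ) ∧ (k : ℕ) < ∑ j ∈ Finset.Iic i, ℓ j}

/-- `A_fix(x, ℓ)`: the law of the sequence `S_1, …, S_n`, where `S_i` is the collection of the
reports `s_k` with `k` in the block of user `i`. -/
noncomputable def fixMechanism {n : ℕ} {X : Type*} {S : Fin n → Type*} [∀ k, MeasurableSpace (S k)]
    (A : AdaptiveRandomizers X S) (ℓ : Fin n → ℕ) (x : Fin n → X) :
    Measure (∀ i : Fin n, ∀ k : Block ℓ i, S k.1) :=
  (reportLaw A x n le_rfl).map (fun s _ k => s k.1)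

/-- `A_fix(σ(D), ℓ)`: the first element of `D` is swapped with the `I`-th one, for `I` uniform on
all `n` indices, and `A_fix(·, ℓ)` is run on the result. -/
noncomputable def swapFixMechanism {n : ℕ} [NeZero n] {X : Type*} {S : Fin n → Type*}
    [∀ k, MeasurableSpace (S k)] (A : AdaptiveRandomizers X S) (ℓ : Fin n → ℕ) (D : Fin n → X) :
    Measure (∀ i : Fin n, ∀ k : Block ℓ i, S k.1) :=
  ∑ I : Fin n, (n : ENNReal)⁻¹ • fixMechanism A ℓ (D ∘ Equiv.swap 0 I)

/-! ### Random walks on graphs -/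

/-- The transition matrix `M i j = A i j / deg i` of the simple random walk on `G`. -/
noncomputable def walkMatrix {n : ℕ} (G : SimpleGraph (Fin n)) [DecidableRel G.Adj] :
    Matrix (Fin n) (Fin n) ℝ :=
  Matrix.of fun i j => G.adjMatrix ℝ i j / (G.degree i : ℝ)

/-- The position distribution `P(t) = (Mᵀ)ᵗ P(0)` after `t` steps. -/
noncomputable def walkDist {n : ℕ} (G : SimpleGraph (Fin n)) [DecidableRel G.Adj]
    (P₀ : Fin n → ℝ) (t : ℕ) : Fin n → ℝ :=
  ((walkMatrix G)ᵀ ^ t) *ᵥ P₀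

/-- `π` is a stationary distribution of the walk: a probability vector with `π = Mᵀ π`. -/
def IsStationaryDist {n : ℕ} (G : SimpleGraph (Fin n)) [DecidableRel G.Adj]
    (π : Fin n → ℝ) : Prop :=
  π ∈ stdSimplex ℝ (Fin n) ∧ π = (walkMatrix G)ᵀ *ᵥ π

/-- The normalized adjacency matrix `B^{-1/2} A B^{-1/2}`, `B` the diagonal matrix of degrees. It is
symmetric and has the same eigenvalues as the transition matrix. -/
noncomputable def normAdjMatrix {n : ℕ} (G : SimpleGraph (Fin n)) [DecidableRel G.Adj] :
    Matrix (Fin n) (Fin n) ℝ :=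
  Matrix.of fun i j => G.adjMatrix ℝ i j / (√(G.degree i : ℝ) * √(G.degree j : ℝ))

theorem normAdjMatrix_isHermitian {n : ℕ} (G : SimpleGraph (Fin n)) [DecidableRel G.Adj] :
    (normAdjMatrix G).IsHermitian := by
  ext i j
  simp [normAdjMatrix, SimpleGraph.adjMatrix_apply, G.adj_comm, mul_comm]

/-- The eigenvalues `α_1 ≥ α_2 ≥ ⋯ ≥ α_n` of the walk, with multiplicity, in decreasing order. -/
noncomputable def walkEigenvalue {n : ℕ} (G : SimpleGraph (Fin n)) [DecidableRel G.Adj]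
    (i : Fin n) : ℝ :=
  (normAdjMatrix_isHermitian G).eigenvalues₀ (Fin.cast (Fintype.card_fin n).symm i)

/-- The spectral gap `min (1 - α_2) (1 - |α_n|)` of a graph with at least two vertices; the
indices start at `0` here and `Fin.rev 0` is the last one. -/
noncomputable def walkSpectralGap {n : ℕ} [NeZero n] (G : SimpleGraph (Fin n))
    [DecidableRel G.Adj] : ℝ :=
  min (1 - walkEigenvalue G 1) (1 - |walkEigenvalue G (Fin.rev 0)|)

/-! ### The privacy parameters -/

/-- `ε₁ = √((1 - 1/n) q) + √(log(1/δ₂) / n)`. -/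
noncomputable def epsOne (n : ℕ) (q δ₂ : ℝ) : ℝ :=
  √((1 - 1 / (n : ℝ)) * q) + √(Real.log (1 / δ₂) / n)

/-- `(e^{ε₀} - 1)² e^{4ε₀} ε₁² / 2 + ε₁ √(2 (e^{ε₀} - 1)² e^{4ε₀} log(1/δ))`. -/
noncomputable def epsCentral (ε₀ ε₁ δ : ℝ) : ℝ :=
  (Real.exp ε₀ - 1) ^ 2 * Real.exp (4 * ε₀) * ε₁ ^ 2 / 2 +
    ε₁ * √(2 * (Real.exp ε₀ - 1) ^ 2 * Real.exp (4 * ε₀) * Real.log (1 / δ))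

/-- The largest admissible `δ₀` for approximate local randomizers,
`(1 - e^{-ε₀}) δ₁ / (4 e^{ε₀} (2 + ln(2/δ₁) / ln(1/(1 - e^{-5ε₀}))))`. -/
noncomputable def deltaZeroBound (ε₀ δ₁ : ℝ) : ℝ :=
  (1 - Real.exp (-ε₀)) * δ₁ /
    (4 * Real.exp ε₀ *
      (2 + Real.log (2 / δ₁) / Real.log (1 / (1 - Real.exp (-5 * ε₀)))))

/-! The walk enters the privacy claims only through `1 / n ≤ q`, by Cauchy–Schwarz for a vector of
sum one. So it suffices to treat every `ε₁` that is at least √((1 - 1/n)/n) + √(log(1/δ₂)/n).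
Handing out the reports in blocks is post-processing.

Pure randomizers, with r = e^{ε₀}: the swapped mechanisms on D and D' are compared through one
reference process, `swapBase`. Relative to it, the density f'_I of the reports on the swapped D' has
nontrivial factors only at steps 0 and I, and likewise f_I for D. Hence the average over I of f_I -
w f'_I, shifted to start at 0 (`swapDeviation`), is a martingale. At a step k ≠ 0 only I = k moves,
and its prefix density is at most r and common to D and D'. The increments lie in intervals of
length (r - 1)(1 + w) r / n, so Hoeffding's lemma bounds the exponential moments. Since Pr_D(E) - w
Pr_{D'}(E) is the integral over E of the martingale minus w - 1, a Chernoff-type estimate gives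
`sum_reportLaw_swap_sub_le`, and `hockeyStick_exponent_bound` optimizes it. This settles the case ε₁
≥ 1/√n. `le_exp_epsCentral_mul_add` covers smaller ε₁: there either δ₂ absorbs the total variation
distance, or r is so large that ε(ε₀) ≥ ε₀.

Approximate randomizers: clip the density relative to the average kernel to [e^{-ε₀}, e^{ε₀}] and
renormalize. The result is purely private, and each step changes probabilities by at most 2δ₀
(`abs_reportLaw_sub_clippedFamily_le`). The average needs a finite alphabet; two datasets involve at
most 2n data elements.

Spectral part: division by √π turns the walk into powers of the symmetric matrix `normAdjMatrix`,
with √π as a fixed unit vector. The component along it contributes 1, and the rest contracts by 1 -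
α per step. -/

/-! ### Joint densities of kernels -/

section CondDensity

variable {α β : Type*} [MeasurableSpace α] [MeasurableSpace β]

theorem compProd_le_smul {N : Measure α} [SFinite N] {K η : Kernel α β} [IsSFiniteKernel K]
    [IsSFiniteKernel η] {r : ENNReal} (h : ∀ s, K s ≤ r • η s) : N ⊗ₘ K ≤ r • (N ⊗ₘ η) := by
  refine Measure.le_iff.2 fun E hE => ?_
  rw [Measure.smul_apply, Measure.compProd_apply hE, Measure.compProd_apply hE, smul_eq_mul,
    ← lintegral_const_mul _ (Kernel.measurable_kernel_prodMk_left hE)]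
  refine lintegral_mono fun s => ?_
  simpa using h s (Prod.mk s ⁻¹' E)

/-- The density of `N ⊗ₘ K` with respect to `N ⊗ₘ κ`. -/
noncomputable def condDensity (N : Measure α) (κ K : Kernel α β) (p : α × β) : ℝ :=
  ((N ⊗ₘ K).rnDeriv (N ⊗ₘ κ) p).toReal

theorem condDensity_nonneg (N : Measure α) (κ K : Kernel α β) (p : α × β) :
    0 ≤ condDensity N κ K p := ENNReal.toReal_nonneg

@[fun_prop]
theorem measurable_condDensity (N : Measure α) (κ K : Kernel α β) :
    Measurable (condDensity N κ K) := (Measure.measurable_rnDeriv _ _).ennreal_toReal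

variable {N : Measure α} [IsFiniteMeasure N] {κ K η : Kernel α β} [IsMarkovKernel κ]
  [IsMarkovKernel K] [IsMarkovKernel η]

theorem withDensity_condDensity (h : N ⊗ₘ K ≪ N ⊗ₘ κ) :
    (N ⊗ₘ κ).withDensity (fun p => ENNReal.ofReal (condDensity N κ K p)) = N ⊗ₘ K := by
  conv_rhs => rw [← Measure.withDensity_rnDeriv_eq _ _ h]
  refine withDensity_congr_ae ?_
  filter_upwards [Measure.rnDeriv_lt_top (N ⊗ₘ K) (N ⊗ₘ κ)] with p hp
  exact ENNReal.ofReal_toReal hp.ne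

theorem lintegral_compProd_eq_condDensity (h : N ⊗ₘ K ≪ N ⊗ₘ κ) {F : α × β → ENNReal}
    (hF : Measurable F) :
    ∫⁻ p, F p ∂(N ⊗ₘ K) = ∫⁻ p, ENNReal.ofReal (condDensity N κ K p) * F p ∂(N ⊗ₘ κ) := by
  conv_lhs => rw [← withDensity_condDensity h]
  rw [lintegral_withDensity_eq_lintegral_mul _ (by fun_prop) hF]
  rfl

theorem condDensity_le_mul (hK : N ⊗ₘ K ≪ N ⊗ₘ κ) (hη : N ⊗ₘ η ≪ N ⊗ₘ κ) {r : ℝ} (hr : 0 ≤ r)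
    (h : ∀ s, K s ≤ ENNReal.ofReal r • η s) :
    ∀ᵐ p ∂(N ⊗ₘ κ), condDensity N κ K p ≤ r * condDensity N κ η p := by
  have h1 : ∀ᵐ p ∂(N ⊗ₘ κ), ENNReal.ofReal (condDensity N κ K p) ≤
      ENNReal.ofReal (r * condDensity N κ η p) := by
    refine ae_le_of_forall_setLIntegral_le_of_sigmaFinite (by fun_prop) fun E hE _ => ?_
    rw [← withDensity_apply _ hE, withDensity_condDensity hK]
    simp_rw [ENNReal.ofReal_mul hr]
    rw [lintegral_const_mul _ (by fun_prop), ← withDensity_apply _ hE, withDensity_condDensity hη]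
    simpa using compProd_le_smul h E
  filter_upwards [h1] with p hp
  exact (ENNReal.ofReal_le_ofReal_iff (mul_nonneg hr (condDensity_nonneg _ _ _ _))).1 hp

theorem condDensity_self : ∀ᵐ p ∂(N ⊗ₘ κ), condDensity N κ κ p = 1 := by
  filter_upwards [Measure.rnDeriv_self (N ⊗ₘ κ)] with p hp
  simp [condDensity, hp]

/-- The exceptional null set depends on `F`, so this does not claim that almost every `K s` has a
density. That weaker form suffices for all uses below and asks nothing of the σ-algebras. -/
theorem lintegral_condDensity_mul (h : N ⊗ₘ K ≪ N ⊗ₘ κ) {F : α × β → ENNReal}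
    (hF : Measurable F) :
    ∀ᵐ s ∂N, ∫⁻ y, ENNReal.ofReal (condDensity N κ K (s, y)) * F (s, y) ∂(κ s) =
      ∫⁻ y, F (s, y) ∂(K s) := by
  refine ae_eq_of_forall_setLIntegral_eq_of_sigmaFinite ?_ ?_ fun C hC _ => ?_
  · exact Measurable.lintegral_kernel_prod_right'
      (f := fun p => ENNReal.ofReal (condDensity N κ K p) * F p) (by fun_prop)
  · exact Measurable.lintegral_kernel_prod_right' hF
  · have h1 := Measure.setLIntegral_compProd (μ := N) (κ := κ)
      (f := fun p => ENNReal.ofReal (condDensity N κ K p) * F p) (by fun_prop) hC MeasurableSet.univ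
    have h2 := Measure.setLIntegral_compProd (μ := N) (κ := K) hF hC MeasurableSet.univ
    simp only [setLIntegral_univ] at h1 h2
    rw [← h1, ← h2, ← lintegral_indicator (hC.prod .univ), ← lintegral_indicator (hC.prod .univ),
      lintegral_compProd_eq_condDensity h (hF.indicator (hC.prod .univ))]
    refine lintegral_congr fun p => ?_
    by_cases hp : p ∈ C ×ˢ Set.univ <;> simp [hp]

theorem lintegral_condDensity (h : N ⊗ₘ K ≪ N ⊗ₘ κ) :
    ∀ᵐ s ∂N, ∫⁻ y, ENNReal.ofReal (condDensity N κ K (s, y)) ∂(κ s) = 1 := by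
  filter_upwards [lintegral_condDensity_mul h measurable_one] with s hs
  simpa using hs

theorem integral_condDensity (h : N ⊗ₘ K ≪ N ⊗ₘ κ) :
    ∀ᵐ s ∂N, Integrable (fun y => condDensity N κ K (s, y)) (κ s) ∧
      ∫ y, condDensity N κ K (s, y) ∂(κ s) = 1 := by
  filter_upwards [lintegral_condDensity h] with s hs
  have hm : Measurable fun y => condDensity N κ K (s, y) := by fun_prop
  constructor
  · refine ⟨hm.aestronglyMeasurable, ?_⟩
    rw [hasFiniteIntegral_iff_ofReal (Filter.Eventually.of_forall fun _ =>
      condDensity_nonneg _ _ _ _), hs]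
    exact ENNReal.one_lt_top
  · rw [integral_eq_lintegral_of_nonneg_ae (Filter.Eventually.of_forall fun _ =>
      condDensity_nonneg _ _ _ _) hm.aestronglyMeasurable, hs, ENNReal.toReal_one]

/-- Hoeffding's lemma for one step of an adapted process. -/
theorem lintegral_exp_step_le {N : Measure α} [SFinite N] {κ : Kernel α β} [IsMarkovKernel κ]
    {W : α → ℝ} {V : α × β → ℝ} (hW : Measurable W) (hV : Measurable V) {c θ : ℝ}
    (lo : α → ℝ) (hb : ∀ᵐ s ∂N, ∀ᵐ y ∂κ s, V (s, y) - W s ∈ Set.Icc (lo s) (lo s + c))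
    (hm : ∀ᵐ s ∂N, ∫ y, (V (s, y) - W s) ∂κ s = 0) :
    ∫⁻ p, ENNReal.ofReal (Real.exp (θ * V p)) ∂(N ⊗ₘ κ) ≤
      ENNReal.ofReal (Real.exp (θ ^ 2 * c ^ 2 / 8)) *
        ∫⁻ s, ENNReal.ofReal (Real.exp (θ * W s)) ∂N := by
  rw [Measure.lintegral_compProd (by fun_prop), ← lintegral_const_mul _ (by fun_prop)]
  refine lintegral_mono_ae ?_
  filter_upwards [hb, hm] with s hbs hms
  -- The position `lo s` of the interval may depend on the past; only its length enters, with
  -- variance proxy c²/4, hence the exponent θ²c²/8.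
  have hsub := hasSubgaussianMGF_of_mem_Icc_of_integral_eq_zero
    (X := fun y => V (s, y) - W s) (μ := κ s) (by fun_prop) hbs hms
  have h1 := hsub.mgf_le θ
  have hi := hsub.integrable_exp_mul θ
  have h2 : ∀ y, ENNReal.ofReal (Real.exp (θ * V (s, y))) =
      ENNReal.ofReal (Real.exp (θ * W s)) *
        ENNReal.ofReal (Real.exp (θ * (V (s, y) - W s))) := fun y => by
    rw [← ENNReal.ofReal_mul (Real.exp_nonneg _), ← Real.exp_add]; ring_nf
  simp_rw [h2]
  rw [lintegral_const_mul _ (by fun_prop), mul_comm]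
  gcongr
  rw [← ofReal_integral_eq_lintegral_ofReal hi
    (Filter.Eventually.of_forall fun _ => Real.exp_nonneg _)]
  refine ENNReal.ofReal_le_ofReal (h1.trans (Real.exp_le_exp.2 (le_of_eq ?_)))
  simp only [NNReal.coe_pow, NNReal.coe_div, coe_nnnorm, NNReal.coe_ofNat, add_sub_cancel_left,
    Real.norm_eq_abs, div_pow, sq_abs]
  ring

end CondDensity

/-! ### Report laws -/

section ReportLaw

variable {n : ℕ} {X : Type*} {S : Fin n → Type*}

/-- Append a report to a sequence of reports. -/
def snocReport (S : Fin n → Type*) {k : ℕ} (hk : k < n)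
    (p : ReportPrefix S k hk.le × S ⟨k, hk⟩) : ReportPrefix S (k + 1) hk :=
  Fin.snoc (α := fun j : Fin (k + 1) => S (j.castLE hk)) p.1 p.2

/-- All reports but the last one, and the last report. -/
def unsnocReport (S : Fin n → Type*) {k : ℕ} (hk : k < n) (s : ReportPrefix S (k + 1) hk) :
    ReportPrefix S k hk.le × S ⟨k, hk⟩ :=
  (fun j => s j.castSucc, s (Fin.last k))

@[simp]
theorem unsnocReport_snocReport {k : ℕ} (hk : k < n)
    (p : ReportPrefix S k hk.le × S ⟨k, hk⟩) : unsnocReport S hk (snocReport S hk p) = p := by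
  refine Prod.ext (funext fun j => ?_) ?_
  · simp [unsnocReport, snocReport]
  · simp [unsnocReport, snocReport]

variable [∀ k, MeasurableSpace (S k)]

@[fun_prop]
theorem measurable_snocReport {k : ℕ} (hk : k < n) : Measurable (snocReport S hk) := by
  refine measurable_pi_iff.2 fun j => ?_
  refine Fin.lastCases ?_ (fun i => ?_) j
  · simp only [snocReport, Fin.snoc_last]
    exact measurable_snd
  · simp only [snocReport, Fin.snoc_castSucc]
    exact (measurable_pi_apply i).comp measurable_fst

@[fun_prop]
theorem measurable_unsnocReport {k : ℕ} (hk : k < n) : Measurable (unsnocReport S hk) := by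
  refine Measurable.prod ?_ (measurable_pi_apply (Fin.last k))
  exact measurable_pi_iff.2 fun j => measurable_pi_apply j.castSucc

theorem reportLaw_succ (A : AdaptiveRandomizers X S) (x : Fin n → X) {k : ℕ} (hk : k < n) :
    reportLaw A x (k + 1) hk =
      (reportLaw A x k hk.le ⊗ₘ A ⟨k, hk⟩ (x ⟨k, hk⟩)).map (snocReport S hk) := rfl

theorem lintegral_reportLaw_succ (A : AdaptiveRandomizers X S) (x : Fin n → X) {k : ℕ} (hk : k < n)
    {F : ReportPrefix S (k + 1) hk → ENNReal} (hF : Measurable F) :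
    ∫⁻ s, F s ∂reportLaw A x (k + 1) hk =
      ∫⁻ p, F (snocReport S hk p) ∂(reportLaw A x k hk.le ⊗ₘ A ⟨k, hk⟩ (x ⟨k, hk⟩)) := by
  rw [reportLaw_succ, lintegral_map hF (by fun_prop)]

instance isProbabilityMeasure_reportLaw (A : AdaptiveRandomizers X S) [∀ k x, IsMarkovKernel (A k x)]
    (x : Fin n → X) (k : ℕ) (hk : k ≤ n) : IsProbabilityMeasure (reportLaw A x k hk) := by
  induction k with
  | zero => unfold reportLaw; infer_instance
  | succ k ih =>
    have := ih (Nat.le_of_succ_le hk)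
    rw [reportLaw_succ A x hk]
    exact Measure.isProbabilityMeasure_map (by fun_prop)

/-- Allows the data alphabet to be replaced by a finite one. -/
theorem reportLaw_comp {Y : Type*} (A : AdaptiveRandomizers X S) (e : Y → X) (z : Fin n → Y)
    (k : ℕ) (hk : k ≤ n) :
    reportLaw (fun k y => A k (e y)) z k hk = reportLaw A (e ∘ z) k hk := by
  induction k with
  | zero => rfl
  | succ k ih =>
    rw [reportLaw_succ _ _ hk, reportLaw_succ _ _ hk, ih]
    rfl

theorem reportLaw_congr (A : AdaptiveRandomizers X S) {x z : Fin n → X}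
    (k : ℕ) (hk : k ≤ n) (h : ∀ j : Fin n, (j : ℕ) < k → x j = z j) :
    reportLaw A x k hk = reportLaw A z k hk := by
  induction k with
  | zero => rfl
  | succ k ih =>
    rw [reportLaw_succ _ _ hk, reportLaw_succ _ _ hk, ih _ fun j hj => h j (by omega),
      h ⟨k, hk⟩ (by simp)]

/-- `A` is pointwise dominated by `e^ε` times itself at any other data element. -/
def IsPureDPFamily (ε : ℝ) (A : AdaptiveRandomizers X S) : Prop :=
  ∀ (k : Fin n) (s : ReportPrefix S k k.isLt.le) (x x' : X),
    A k x s ≤ ENNReal.ofReal (Real.exp ε) • A k x' s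

theorem DPClose.le_smul {Ω : Type*} [MeasurableSpace Ω] {ε : ℝ} {μ ν : Measure Ω}
    [IsFiniteMeasure μ] [IsFiniteMeasure ν] (h : DPClose ε 0 μ ν) :
    μ ≤ ENNReal.ofReal (Real.exp ε) • ν := by
  refine Measure.le_iff.2 fun E hE => ?_
  have h1 := h E hE
  rw [add_zero] at h1
  rw [Measure.smul_apply, smul_eq_mul, ← ENNReal.ofReal_toReal (measure_ne_top μ E),
    ← ENNReal.ofReal_toReal (measure_ne_top ν E), ← ENNReal.ofReal_mul (Real.exp_nonneg _)]
  exact ENNReal.ofReal_le_ofReal h1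

theorem IsLocalDPFamily.isPureDPFamily {A : AdaptiveRandomizers X S}
    [∀ k x, IsMarkovKernel (A k x)] {ε : ℝ} (h : IsLocalDPFamily ε 0 A) : IsPureDPFamily ε A :=
  fun k s x x' => (h k s x x').le_smul

/-- Changing one data element changes the law of the reports by a factor at most `e^ε`. -/
theorem reportLaw_le_smul {A : AdaptiveRandomizers X S} [∀ k x, IsMarkovKernel (A k x)] {ε : ℝ}
    (hA : IsPureDPFamily ε A) {x z : Fin n → X} (i : Fin n)
    (h : ∀ j, j ≠ i → x j = z j) (k : ℕ) (hk : k ≤ n) :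
    reportLaw A x k hk ≤
      (if (i : ℕ) < k then ENNReal.ofReal (Real.exp ε) else 1) • reportLaw A z k hk := by
  induction k with
  | zero => exact le_of_eq (by simp [reportLaw])
  | succ k ih =>
    have ih := ih (Nat.le_of_succ_le hk)
    rw [reportLaw_succ _ _ hk, reportLaw_succ _ _ hk, ← Measure.map_smul]
    refine Measure.map_mono ?_ (by fun_prop)
    rcases lt_trichotomy (i : ℕ) k with hik | hik | hik
    · have : x ⟨k, hk⟩ = z ⟨k, hk⟩ := h _ fun hh => by simp [← hh] at hik
      rw [if_pos hik] at ih
      rw [if_pos (by omega), this, ← Measure.compProd_smul_left]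
      exact Measure.le_iff.2 fun E hE => by
        rw [Measure.compProd_apply hE, Measure.compProd_apply hE]
        exact lintegral_mono' ih le_rfl
    · rw [if_pos (by omega), reportLaw_congr A k _ (x := x) (z := z)
        (fun j hj => h j fun hh => by simp [hh] at hj; omega)]
      exact compProd_le_smul fun s => hA ⟨k, hk⟩ s _ _
    · have : x ⟨k, hk⟩ = z ⟨k, hk⟩ := h _ fun hh => by simp [← hh] at hik
      rw [if_neg (by omega), one_smul, this, reportLaw_congr A k _ (x := x) (z := z)
        (fun j hj => h j fun hh => by simp [hh] at hj; omega)]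

theorem measurable_blocks (ℓ : Fin n → ℕ) : Measurable
    (fun (s : ReportPrefix S n le_rfl) (i : Fin n) (k : Block ℓ i) => (s k.1 : S k.1)) :=
  measurable_pi_iff.2 fun _ => measurable_pi_iff.2 fun k => measurable_pi_apply k.1

/-- The blocks are a measurable function of the full report sequence, so every event about them
pulls back to an event about `reportLaw`. -/
theorem swapFixMechanism_real [NeZero n] (A : AdaptiveRandomizers X S)
    [∀ k x, IsMarkovKernel (A k x)] (ℓ : Fin n → ℕ) (D : Fin n → X)
    {E : Set (∀ i : Fin n, ∀ k : Block ℓ i, S k.1)} (hE : MeasurableSet E) :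
    (swapFixMechanism A ℓ D).real E =
      (n : ℝ)⁻¹ * ∑ I : Fin n, (reportLaw A (D ∘ Equiv.swap 0 I) n le_rfl).real
        ((fun (s : ReportPrefix S n le_rfl) (i : Fin n) (k : Block ℓ i) => (s k.1 : S k.1)) ⁻¹' E) := by
  simp only [swapFixMechanism, fixMechanism, Measure.real, Measure.coe_finsetSum,
    Finset.sum_apply, Measure.smul_apply, smul_eq_mul]
  rw [ENNReal.toReal_sum (fun I _ => by
    rw [Measure.map_apply (measurable_blocks ℓ) hE]
    exact ENNReal.mul_ne_top (by simp [NeZero.ne n]) (measure_ne_top _ _)), Finset.mul_sum]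
  refine Finset.sum_congr rfl fun I _ => ?_
  rw [ENNReal.toReal_mul, Measure.map_apply (measurable_blocks ℓ) hE]
  simp

end ReportLaw

/-! ### Averages of kernels -/

section AvgKernel

variable {α β J : Type*} [MeasurableSpace α] [MeasurableSpace β] [Fintype J]

/-- The uniform mixture of finitely many kernels. -/
noncomputable def avgKernel (K : J → Kernel α β) : Kernel α β where
  toFun s := (Fintype.card J : ENNReal)⁻¹ • ∑ j, K j s
  measurable' := by
    refine Measure.measurable_of_measurable_coe _ fun E hE => ?_
    simp only [Measure.smul_apply, Measure.coe_finsetSum, Finset.sum_apply, smul_eq_mul]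
    exact (Finset.measurable_sum _ fun j _ => Kernel.measurable_coe (K j) hE).const_mul _

theorem avgKernel_apply' (K : J → Kernel α β) (s : α) (E : Set β) :
    avgKernel K s E = (Fintype.card J : ENNReal)⁻¹ * ∑ j, K j s E := by
  change ((Fintype.card J : ENNReal)⁻¹ • ∑ j, K j s) E = _
  simp

variable [Nonempty J]

theorem inv_card_mul_sum_const (c : ENNReal) :
    (Fintype.card J : ENNReal)⁻¹ * ∑ _j : J, c = c := by
  rw [Finset.sum_const, Finset.card_univ, nsmul_eq_mul, ← mul_assoc,
    ENNReal.inv_mul_cancel (by simp) (by simp), one_mul]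

instance isMarkovKernel_avgKernel (K : J → Kernel α β) [∀ j, IsMarkovKernel (K j)] :
    IsMarkovKernel (avgKernel K) where
  isProbabilityMeasure s := ⟨by
    rw [avgKernel_apply']
    simp only [measure_univ]
    exact inv_card_mul_sum_const 1⟩

theorem le_smul_avgKernel {K : J → Kernel α β} {s : α} {μ : Measure β} {r : ENNReal}
    (h : ∀ j, μ ≤ r • K j s) : μ ≤ r • avgKernel K s := by
  refine Measure.le_iff.2 fun E _ => ?_
  rw [Measure.smul_apply, smul_eq_mul, avgKernel_apply', mul_left_comm, Finset.mul_sum,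
    ← inv_card_mul_sum_const (J := J) (μ E)]
  gcongr with j
  simpa using h j E

theorem avgKernel_le_smul {K : J → Kernel α β} {s : α} {μ : Measure β} {r : ENNReal}
    (h : ∀ j, K j s ≤ r • μ) : avgKernel K s ≤ r • μ := by
  refine Measure.le_iff.2 fun E _ => ?_
  rw [Measure.smul_apply, smul_eq_mul, avgKernel_apply', ← inv_card_mul_sum_const (J := J) (r * μ E)]
  gcongr with j
  simpa using h j E

theorem apply_le_card_mul_avgKernel (K : J → Kernel α β) (j : J) (s : α) :
    K j s ≤ (Fintype.card J : ENNReal) • avgKernel K s := by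
  refine Measure.le_iff.2 fun E _ => ?_
  rw [Measure.smul_apply, smul_eq_mul, avgKernel_apply', ← mul_assoc,
    ENNReal.mul_inv_cancel (by simp) (by simp), one_mul]
  exact Finset.single_le_sum (f := fun j => K j s E) (fun _ _ => zero_le) (Finset.mem_univ j)

theorem compProd_avgKernel_apply (N : Measure α) [SFinite N] (K : J → Kernel α β)
    [∀ j, IsMarkovKernel (K j)] {E : Set (α × β)} (hE : MeasurableSet E) :
    (N ⊗ₘ avgKernel K) E = (Fintype.card J : ENNReal)⁻¹ * ∑ j, (N ⊗ₘ K j) E := by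
  simp_rw [Measure.compProd_apply hE, avgKernel_apply']
  rw [lintegral_const_mul _ (Finset.measurable_sum _ fun j _ =>
      Kernel.measurable_kernel_prodMk_left hE),
    lintegral_finsetSum _ fun j _ => Kernel.measurable_kernel_prodMk_left hE]

theorem compProd_absolutelyContinuous_avgKernel (N : Measure α) [SFinite N] (K : J → Kernel α β)
    [∀ j, IsMarkovKernel (K j)] (j : J) : N ⊗ₘ K j ≪ N ⊗ₘ avgKernel K :=
  Measure.absolutelyContinuous_of_le_smul
    (compProd_le_smul fun s => apply_le_card_mul_avgKernel K j s)

/-- Over every measurable set the component laws sum to `card J` times the mixture. This identity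
collapses the first martingale increment to a single difference. -/
theorem sum_condDensity_avgKernel (N : Measure α) [IsFiniteMeasure N] (K : J → Kernel α β)
    [∀ j, IsMarkovKernel (K j)] :
    ∀ᵐ p ∂(N ⊗ₘ avgKernel K), ∑ j, condDensity N (avgKernel K) (K j) p = Fintype.card J := by
  have h : ∀ᵐ p ∂(N ⊗ₘ avgKernel K),
      ENNReal.ofReal (∑ j, condDensity N (avgKernel K) (K j) p) = Fintype.card J := by
    refine ae_eq_of_forall_setLIntegral_eq_of_sigmaFinite (by fun_prop) (by fun_prop)
      fun E hE _ => ?_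
    simp_rw [ENNReal.ofReal_sum_of_nonneg fun j _ => condDensity_nonneg N (avgKernel K) (K j) _]
    rw [lintegral_finsetSum _ (by fun_prop), lintegral_const, Measure.restrict_apply_univ,
      compProd_avgKernel_apply N K hE, ← mul_assoc, ENNReal.mul_inv_cancel (by simp) (by simp),
      one_mul]
    refine Finset.sum_congr rfl fun j _ => ?_
    rw [← withDensity_apply _ hE,
      withDensity_condDensity (compProd_absolutelyContinuous_avgKernel N K j)]
  filter_upwards [h] with p hp
  rw [← ENNReal.toReal_ofReal (Finset.sum_nonneg fun j _ => condDensity_nonneg _ _ _ _), hp]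
  simp

end AvgKernel

/-! ### Densities of report laws -/

section ReportDensity

variable {n : ℕ} {X : Type*} {S : Fin n → Type*} [∀ k, MeasurableSpace (S k)]

/-- The law of the first `k` reports for a family that ignores the data. -/
noncomputable abbrev baseLaw (B : AdaptiveRandomizers Unit S) (k : ℕ) (hk : k ≤ n) :
    Measure (ReportPrefix S k hk) := reportLaw B (fun _ => ()) k hk

/-- The density of the `k`-th report on the data element `z`, relative to the family `B`. -/
noncomputable def stepDensity (B : AdaptiveRandomizers Unit S) (A : AdaptiveRandomizers X S)
    (k : Fin n) (z : X) : ReportPrefix S k k.isLt.le × S k → ℝ :=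
  condDensity (baseLaw B k k.isLt.le) (B k ()) (A k z)

/-- The density of the first `k` reports on the dataset `z`, relative to the family `B`. -/
noncomputable def reportDensity (B : AdaptiveRandomizers Unit S) (A : AdaptiveRandomizers X S)
    (z : Fin n → X) : (k : ℕ) → (hk : k ≤ n) → ReportPrefix S k hk → ℝ
  | 0, _ => fun _ => 1
  | k + 1, hk => fun s =>
      reportDensity B A z k (Nat.le_of_succ_le hk) (unsnocReport S hk s).1 *
        stepDensity B A ⟨k, hk⟩ (z ⟨k, hk⟩) (unsnocReport S hk s)

variable {B : AdaptiveRandomizers Unit S} {A : AdaptiveRandomizers X S}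

theorem stepDensity_nonneg (k : Fin n) (z : X) (p : ReportPrefix S k k.isLt.le × S k) :
    0 ≤ stepDensity B A k z p := condDensity_nonneg _ _ _ _

@[fun_prop]
theorem measurable_stepDensity (k : Fin n) (z : X) : Measurable (stepDensity B A k z) :=
  measurable_condDensity _ _ _

theorem reportDensity_snocReport (z : Fin n → X) {k : ℕ} (hk : k < n)
    (p : ReportPrefix S k hk.le × S ⟨k, hk⟩) :
    reportDensity B A z (k + 1) hk (snocReport S hk p) =
      reportDensity B A z k hk.le p.1 * stepDensity B A ⟨k, hk⟩ (z ⟨k, hk⟩) p := by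
  simp only [reportDensity, unsnocReport_snocReport]

@[fun_prop]
theorem measurable_reportDensity (z : Fin n → X) (k : ℕ) (hk : k ≤ n) :
    Measurable (reportDensity B A z k hk) := by
  induction k with
  | zero => exact measurable_const
  | succ k ih =>
    have := ih (Nat.le_of_succ_le hk)
    exact (this.comp (measurable_fst.comp (measurable_unsnocReport hk))).mul
      ((measurable_stepDensity ⟨k, hk⟩ _).comp (measurable_unsnocReport hk))

theorem reportDensity_nonneg (z : Fin n → X) (k : ℕ) (hk : k ≤ n) (s : ReportPrefix S k hk) :
    0 ≤ reportDensity B A z k hk s := by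
  induction k with
  | zero => exact zero_le_one
  | succ k ih => exact mul_nonneg (ih (Nat.le_of_succ_le hk) _) (stepDensity_nonneg _ _ _)

theorem reportDensity_congr {x z : Fin n → X} (k : ℕ) (hk : k ≤ n)
    (h : ∀ j : Fin n, (j : ℕ) < k → x j = z j) :
    reportDensity B A x k hk = reportDensity B A z k hk := by
  induction k with
  | zero => rfl
  | succ k ih =>
    unfold reportDensity
    rw [ih _ fun j hj => h j (by omega), h ⟨k, hk⟩ (by simp)]

variable [∀ k x, IsMarkovKernel (B k x)] [∀ k x, IsMarkovKernel (A k x)]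

/-- Chain rule: disintegrate the last step, apply induction to the prefix, then trade the last
kernel for its joint density over the base prefix law. -/
theorem lintegral_reportLaw_eq_reportDensity
    (hac : ∀ (k : Fin n) z, baseLaw B k k.isLt.le ⊗ₘ A k z ≪ baseLaw B k k.isLt.le ⊗ₘ B k ())
    (z : Fin n → X) (k : ℕ) (hk : k ≤ n)
    {F : ReportPrefix S k hk → ENNReal} (hF : Measurable F) :
    ∫⁻ s, F s ∂reportLaw A z k hk =
      ∫⁻ s, ENNReal.ofReal (reportDensity B A z k hk s) * F s ∂baseLaw B k hk := by
  induction k with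
  | zero => simp [reportDensity, reportLaw]
  | succ k ih =>
    have hk' : k < n := hk
    rw [lintegral_reportLaw_succ A z hk hF, lintegral_reportLaw_succ B _ hk (by fun_prop),
      Measure.lintegral_compProd (by fun_prop), ih (Nat.le_of_succ_le hk)
      (Measurable.lintegral_kernel_prod_right' (f := fun p => F (snocReport S hk p))
        (by fun_prop))]
    have h1 : ∀ s, ENNReal.ofReal (reportDensity B A z k hk'.le s) *
        ∫⁻ y, F (snocReport S hk (s, y)) ∂A ⟨k, hk⟩ (z ⟨k, hk⟩) s =
        ∫⁻ y, ENNReal.ofReal (reportDensity B A z k hk'.le s) * F (snocReport S hk (s, y))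
          ∂A ⟨k, hk⟩ (z ⟨k, hk⟩) s := fun s => by
      rw [lintegral_const_mul _ (by fun_prop)]
    simp_rw [h1]
    rw [← Measure.lintegral_compProd (f := fun p =>
      ENNReal.ofReal (reportDensity B A z k hk'.le p.1) * F (snocReport S hk p)) (by fun_prop),
      lintegral_compProd_eq_condDensity (hac ⟨k, hk⟩ _) (by fun_prop)]
    refine lintegral_congr fun p => ?_
    rw [reportDensity_snocReport, ENNReal.ofReal_mul (reportDensity_nonneg _ _ _ _), ← mul_assoc,
      mul_comm (ENNReal.ofReal (condDensity _ _ _ _))]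
    rfl

theorem reportLaw_apply_eq_reportDensity
    (hac : ∀ (k : Fin n) z, baseLaw B k k.isLt.le ⊗ₘ A k z ≪ baseLaw B k k.isLt.le ⊗ₘ B k ())
    (z : Fin n → X) (k : ℕ) (hk : k ≤ n) {E : Set (ReportPrefix S k hk)} (hE : MeasurableSet E) :
    reportLaw A z k hk E =
      ∫⁻ s in E, ENNReal.ofReal (reportDensity B A z k hk s) ∂baseLaw B k hk := by
  rw [← lintegral_indicator_one hE, lintegral_reportLaw_eq_reportDensity hac z k hk
    (measurable_one.indicator hE), ← lintegral_indicator hE]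
  refine lintegral_congr fun s => ?_
  by_cases hs : s ∈ E <;> simp [hs]

theorem integrable_reportDensity
    (hac : ∀ (k : Fin n) z, baseLaw B k k.isLt.le ⊗ₘ A k z ≪ baseLaw B k k.isLt.le ⊗ₘ B k ())
    (z : Fin n → X) (k : ℕ) (hk : k ≤ n) :
    Integrable (reportDensity B A z k hk) (baseLaw B k hk) := by
  refine ⟨(measurable_reportDensity z k hk).aestronglyMeasurable, ?_⟩
  rw [hasFiniteIntegral_iff_ofReal (Filter.Eventually.of_forall fun _ =>
      reportDensity_nonneg _ _ _ _), ← setLIntegral_univ,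
      ← reportLaw_apply_eq_reportDensity hac z k hk MeasurableSet.univ]
  exact measure_lt_top _ _

theorem reportLaw_real_eq_reportDensity
    (hac : ∀ (k : Fin n) z, baseLaw B k k.isLt.le ⊗ₘ A k z ≪ baseLaw B k k.isLt.le ⊗ₘ B k ())
    (z : Fin n → X) (k : ℕ) (hk : k ≤ n) {E : Set (ReportPrefix S k hk)} (hE : MeasurableSet E) :
    (reportLaw A z k hk).real E = ∫ s in E, reportDensity B A z k hk s ∂baseLaw B k hk := by
  rw [Measure.real, reportLaw_apply_eq_reportDensity hac z k hk hE,
    integral_eq_lintegral_of_nonneg_ae (Filter.Eventually.of_forall fun _ =>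
      reportDensity_nonneg _ _ _ _) (measurable_reportDensity z k hk).aestronglyMeasurable]

end ReportDensity

/-! ### The hockey-stick divergence of the swapped mechanism -/

section Swap

/-- From v ≥ u/r the difference is at most u(1 - w/r) ≤ r - w; from u ≥ v/r it is at least v(1/r -
w) ≥ 1 - wr. The interval has length (r - 1)(1 + w), whereas bounding `u` and `w * v` separately
would give r(1 + w). -/
theorem sub_mul_mem_Icc_of_le_mul {r w u v : ℝ} (hw : 1 ≤ w) (hwr : w ≤ r)
    (hu : u ≤ r) (hv : v ≤ r) (huv : u ≤ r * v) (hvu : v ≤ r * u) :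
    u - w * v ∈ Set.Icc (1 - w * r) (r - w) := by
  have hr : 0 < r := by linarith
  constructor
  · have : 0 ≤ (w * r - 1) * (r - v) := mul_nonneg (by nlinarith) (by linarith)
    nlinarith
  · have : 0 ≤ (r - w) * (r - u) := mul_nonneg (by linarith) (by linarith)
    have : w * u ≤ w * (r * v) := by gcongr
    nlinarith

variable {n : ℕ} [NeZero n] {X : Type*} {S : Fin n → Type*} [∀ k, MeasurableSpace (S k)]

/-- The reference process: the first report is drawn from the uniform mixture over the dataset `D`,
and the later reports use their own data elements. -/
noncomputable def swapBase (A : AdaptiveRandomizers X S) (D : Fin n → X) :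
    AdaptiveRandomizers Unit S :=
  fun k _ => if k = 0 then avgKernel (fun I => A k (D I)) else A k (D k)

instance isMarkovKernel_swapBase (A : AdaptiveRandomizers X S) [∀ k x, IsMarkovKernel (A k x)]
    (D : Fin n → X) (k : Fin n) (x : Unit) : IsMarkovKernel (swapBase A D k x) := by
  unfold swapBase; split_ifs <;> infer_instance

theorem swapBase_of_ne (A : AdaptiveRandomizers X S) (D : Fin n → X) {k : Fin n} (hk : k ≠ 0)
    (x : Unit) : swapBase A D k x = A k (D k) := if_neg hk

theorem swapBase_of_eq (A : AdaptiveRandomizers X S) (D : Fin n → X) {k : Fin n} (hk : k = 0)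
    (x : Unit) : swapBase A D k x = avgKernel (fun I => A k (D I)) := if_pos hk

variable {A : AdaptiveRandomizers X S} {a : ℝ}

theorem IsPureDPFamily.le_swapBase (hA : IsPureDPFamily a A) (D : Fin n → X) (k : Fin n)
    (s : ReportPrefix S k k.isLt.le) (z : X) :
    A k z s ≤ ENNReal.ofReal (Real.exp a) • swapBase A D k () s := by
  by_cases hk : k = 0
  · rw [swapBase_of_eq A D hk]; exact le_smul_avgKernel fun I => hA k s _ _
  · rw [swapBase_of_ne A D hk]; exact hA k s _ _

/-- `n⁻¹ ∑ I, (f_I - w f'_I) + (w - 1)` for the densities `f_I`, `f'_I` of the first `k` reports on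
the swapped datasets. -/
noncomputable def swapDeviation (A : AdaptiveRandomizers X S) (D D' : Fin n → X) (w : ℝ) (k : ℕ)
    (hk : k ≤ n) (s : ReportPrefix S k hk) : ℝ :=
  (n : ℝ)⁻¹ * ∑ I, (reportDensity (swapBase A D') A (D ∘ Equiv.swap 0 I) k hk s -
    w * reportDensity (swapBase A D') A (D' ∘ Equiv.swap 0 I) k hk s) + (w - 1)

@[fun_prop]
theorem measurable_swapDeviation (D D' : Fin n → X) (w : ℝ) (k : ℕ) (hk : k ≤ n) :
    Measurable (swapDeviation A D D' w k hk) := by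
  unfold swapDeviation
  fun_prop

theorem swapDeviation_zero (D D' : Fin n → X) (w : ℝ) (hk : 0 ≤ n) (s : ReportPrefix S 0 hk) :
    swapDeviation A D D' w 0 hk s = 0 := by
  have : (n : ℝ) ≠ 0 := by simp [NeZero.ne n]
  simp only [swapDeviation, reportDensity, Finset.sum_const, Finset.card_univ, Fintype.card_fin,
    nsmul_eq_mul]
  field_simp
  ring

/-- Written so that every index whose step density equals 1 drops out. -/
theorem swapDeviation_snoc_sub (D D' : Fin n → X) (w : ℝ) {k : ℕ} (hk : k < n)
    (p : ReportPrefix S k hk.le × S ⟨k, hk⟩) :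
    swapDeviation A D D' w (k + 1) hk (snocReport S hk p) - swapDeviation A D D' w k hk.le p.1 =
      (n : ℝ)⁻¹ * ∑ I, (reportDensity (swapBase A D') A (D ∘ Equiv.swap 0 I) k hk.le p.1 *
          (stepDensity (swapBase A D') A ⟨k, hk⟩ ((D ∘ Equiv.swap 0 I) ⟨k, hk⟩) p - 1) -
        w * (reportDensity (swapBase A D') A (D' ∘ Equiv.swap 0 I) k hk.le p.1 *
          (stepDensity (swapBase A D') A ⟨k, hk⟩ ((D' ∘ Equiv.swap 0 I) ⟨k, hk⟩) p - 1))) := by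
  unfold swapDeviation
  rw [add_sub_add_right_eq_sub, ← mul_sub, ← Finset.sum_sub_distrib]
  congr 1
  refine Finset.sum_congr rfl fun I _ => ?_
  rw [reportDensity_snocReport, reportDensity_snocReport]
  ring

variable [∀ k x, IsMarkovKernel (A k x)]

theorem IsPureDPFamily.ac_swapBase (hA : IsPureDPFamily a A) (D : Fin n → X) (k : Fin n) (z : X) :
    baseLaw (swapBase A D) k k.isLt.le ⊗ₘ A k z ≪
      baseLaw (swapBase A D) k k.isLt.le ⊗ₘ swapBase A D k () :=
  Measure.absolutelyContinuous_of_le_smul (compProd_le_smul fun s => hA.le_swapBase D k s z)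

theorem stepDensity_swapBase_le (hA : IsPureDPFamily a A) (D : Fin n → X) (k : Fin n) (z : X) :
    ∀ᵐ p ∂(baseLaw (swapBase A D) k k.isLt.le ⊗ₘ swapBase A D k ()),
      stepDensity (swapBase A D) A k z p ≤ Real.exp a := by
  filter_upwards [condDensity_le_mul (N := baseLaw (swapBase A D) k k.isLt.le)
    (hA.ac_swapBase D k z) Measure.AbsolutelyContinuous.rfl (Real.exp_nonneg a)
    (fun s => hA.le_swapBase D k s z), condDensity_self (N := baseLaw (swapBase A D) k k.isLt.le)
    (κ := swapBase A D k ())] with p hp hp1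
  rwa [hp1, mul_one] at hp

theorem stepDensity_swapBase_le_mul (hA : IsPureDPFamily a A) (D : Fin n → X) (k : Fin n)
    (z z' : X) :
    ∀ᵐ p ∂(baseLaw (swapBase A D) k k.isLt.le ⊗ₘ swapBase A D k ()),
      stepDensity (swapBase A D) A k z p ≤ Real.exp a * stepDensity (swapBase A D) A k z' p :=
  condDensity_le_mul (hA.ac_swapBase D k z) (hA.ac_swapBase D k z') (Real.exp_nonneg a)
    (fun s => hA k s z z')

theorem stepDensity_swapBase_self (D : Fin n → X) {k : Fin n} (hk : k ≠ 0) :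
    ∀ᵐ p ∂(baseLaw (swapBase A D) k k.isLt.le ⊗ₘ swapBase A D k ()),
      stepDensity (swapBase A D) A k (D k) p = 1 := by
  have h := condDensity_self (N := baseLaw (swapBase A D) k k.isLt.le) (κ := swapBase A D k ())
  simp only [stepDensity, swapBase_of_ne A D hk] at h ⊢
  exact h

theorem sum_stepDensity_swapBase (D : Fin n → X) {k : Fin n} (hk : k = 0) :
    ∀ᵐ p ∂(baseLaw (swapBase A D) k k.isLt.le ⊗ₘ swapBase A D k ()),
      ∑ I, stepDensity (swapBase A D) A k (D I) p = n := by
  have h := sum_condDensity_avgKernel (baseLaw (swapBase A D) k k.isLt.le) (fun I => A k (D I))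
  simp only [stepDensity, swapBase_of_eq A D hk, Fintype.card_fin] at h ⊢
  exact h

/-- After step 0 the dataset agrees with the reference and all step densities are 1; step 0 alone
contributes a factor, at most e^a. -/
theorem reportDensity_swapBase_le (ha : 0 ≤ a) (hA : IsPureDPFamily a A) (D z : Fin n → X) (k : ℕ)
    (hk : k ≤ n) (h : ∀ j : Fin n, j ≠ 0 → (j : ℕ) < k → z j = D j) :
    ∀ᵐ s ∂baseLaw (swapBase A D) k hk, reportDensity (swapBase A D) A z k hk s ≤ Real.exp a := by
  induction k with
  | zero => exact Filter.Eventually.of_forall fun s => Real.one_le_exp ha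
  | succ k ih =>
    have hk' : k < n := hk
    rw [baseLaw, reportLaw_succ _ _ hk, ae_map_iff (by fun_prop)
      (measurableSet_le (by fun_prop) (by fun_prop))]
    simp only [reportDensity_snocReport]
    have ih := ih hk'.le fun j hj hjk => h j hj (by omega)
    have ih := Measure.ae_compProd_of_ae_fst (swapBase A D ⟨k, hk⟩ ())
      (measurableSet_le (by fun_prop) (by fun_prop)) ih
    by_cases hk0 : (⟨k, hk⟩ : Fin n) = 0
    · obtain rfl : k = 0 := by simpa [Fin.ext_iff] using hk0
      filter_upwards [stepDensity_swapBase_le hA D ⟨0, hk⟩ (z ⟨0, hk⟩)] with p hp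
      simpa [reportDensity] using hp
    · have h1 := stepDensity_swapBase_self (A := A) D hk0
      rw [← h ⟨k, hk⟩ hk0 (by simp)] at h1
      filter_upwards [h1, ih] with p hp hp2
      rw [hp, mul_one]
      exact hp2

/-- The martingale property: every step density has conditional mean one. -/
theorem integral_swapDeviation_snoc_sub (hA : IsPureDPFamily a A) (D D' : Fin n → X) (w : ℝ)
    {k : ℕ} (hk : k < n) :
    ∀ᵐ s ∂baseLaw (swapBase A D') k hk.le,
      ∫ y, (swapDeviation A D D' w (k + 1) hk (snocReport S hk (s, y)) -
        swapDeviation A D D' w k hk.le s) ∂(swapBase A D' ⟨k, hk⟩ () s) = 0 := by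
  have : IsMarkovKernel
    (swapBase A D' ⟨k, hk⟩ () : Kernel (ReportPrefix S k hk.le) (S ⟨k, hk⟩)) :=
    isMarkovKernel_swapBase A D' ⟨k, hk⟩ ()
  have h1 : ∀ z : Fin n → X, ∀ᵐ s ∂baseLaw (swapBase A D') k hk.le, ∀ I : Fin n,
      Integrable (fun y => stepDensity (swapBase A D') A ⟨k, hk⟩
        ((z ∘ Equiv.swap 0 I) ⟨k, hk⟩) (s, y)) (swapBase A D' ⟨k, hk⟩ () s) ∧
      ∫ y, stepDensity (swapBase A D') A ⟨k, hk⟩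
        ((z ∘ Equiv.swap 0 I) ⟨k, hk⟩) (s, y) ∂(swapBase A D' ⟨k, hk⟩ () s) = 1 := fun z =>
    ae_all_iff.2 fun I => integral_condDensity (hA.ac_swapBase D' ⟨k, hk⟩ _)
  filter_upwards [h1 D, h1 D'] with s hs hs'
  simp_rw [fun y => swapDeviation_snoc_sub (A := A) D D' w hk (s, y)]
  have hi : ∀ (c : ℝ) {g : S ⟨k, hk⟩ → ℝ}, Integrable g (swapBase A D' ⟨k, hk⟩ () s) →
      Integrable (fun y => c * (g y - 1)) (swapBase A D' ⟨k, hk⟩ () s) := fun c g hg =>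
    (hg.sub (integrable_const 1)).const_mul c
  have hz : ∀ (c : ℝ) {g : S ⟨k, hk⟩ → ℝ}, Integrable g (swapBase A D' ⟨k, hk⟩ () s) →
      ∫ y, g y ∂(swapBase A D' ⟨k, hk⟩ () s) = 1 →
      ∫ y, c * (g y - 1) ∂(swapBase A D' ⟨k, hk⟩ () s) = 0 := fun c g hg hg1 => by
    rw [integral_const_mul, integral_sub hg (integrable_const 1), hg1]
    simp
  rw [integral_const_mul, integral_finsetSum]
  swap
  · intro I _
    exact (hi _ (hs I).1).sub ((hi _ (hs' I).1).const_mul w)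
  rw [Finset.sum_eq_zero fun I _ => ?_, mul_zero]
  rw [integral_sub (hi _ (hs I).1) ((hi _ (hs' I).1).const_mul w), hz _ (hs I).1 (hs I).2,
    integral_const_mul, hz _ (hs' I).1 (hs' I).2]
  simp

/-- At a step k ≠ 0, each I ≠ k uses the same data element as the reference, so only I = k moves,
scaled by its prefix density. At step 0 every I moves, but the densities over `D'` sum to n, which
leaves the difference of the densities of `D 0` and `D' 0`. -/
theorem swapDeviation_snoc_sub_mem_Icc (ha : 0 ≤ a) (hA : IsPureDPFamily a A) {D D' : Fin n → X}
    (hD : ∀ i, i ≠ 0 → D i = D' i) {w : ℝ} (hw : 1 ≤ w) (hwa : w ≤ Real.exp a)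
    {k : ℕ} (hk : k < n) :
    ∃ lo : ReportPrefix S k hk.le → ℝ, ∀ᵐ s ∂baseLaw (swapBase A D') k hk.le,
      ∀ᵐ y ∂(swapBase A D' ⟨k, hk⟩ () s),
        swapDeviation A D D' w (k + 1) hk (snocReport S hk (s, y)) -
          swapDeviation A D D' w k hk.le s ∈
        Set.Icc (lo s) (lo s + (Real.exp a - 1) * (1 + w) * Real.exp a / n) := by
  have : IsMarkovKernel
    (swapBase A D' ⟨k, hk⟩ () : Kernel (ReportPrefix S k hk.le) (S ⟨k, hk⟩)) :=
    isMarkovKernel_swapBase A D' ⟨k, hk⟩ ()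
  have hr1 : 1 ≤ Real.exp a := Real.one_le_exp ha
  set r := Real.exp a with hr
  have hn : (0 : ℝ) < n := by exact_mod_cast NeZero.pos n
  by_cases hk0 : (⟨k, hk⟩ : Fin n) = 0
  · refine ⟨fun _ => -((r - 1) / n), Measure.ae_ae_of_ae_compProd
      (p := fun p => swapDeviation A D D' w (k + 1) hk (snocReport S hk p) -
          swapDeviation A D D' w k hk.le p.1 ∈
        Set.Icc (-((r - 1) / n)) (-((r - 1) / n) + (r - 1) * (1 + w) * r / n)) ?_⟩
    obtain rfl : k = 0 := by simpa [Fin.ext_iff] using hk0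
    filter_upwards [sum_stepDensity_swapBase (A := A) D' hk0,
      stepDensity_swapBase_le hA D' ⟨0, hk⟩ (D 0), stepDensity_swapBase_le hA D' ⟨0, hk⟩ (D' 0),
      stepDensity_swapBase_le_mul hA D' ⟨0, hk⟩ (D 0) (D' 0),
      stepDensity_swapBase_le_mul hA D' ⟨0, hk⟩ (D' 0) (D 0)] with p hsum hu hv huv hvu
    have key : swapDeviation A D D' w (0 + 1) hk (snocReport S hk p) -
        swapDeviation A D D' w 0 hk.le p.1 =
        (stepDensity (swapBase A D') A ⟨0, hk⟩ (D 0) p -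
          stepDensity (swapBase A D') A ⟨0, hk⟩ (D' 0) p) / n := by
      rw [swapDeviation_snoc_sub]
      have hz : ∀ z : Fin n → X, ∀ I, (z ∘ Equiv.swap 0 I) ⟨0, hk⟩ = z I := fun z I => by
        rw [hk0]; simp
      simp only [reportDensity, hz, one_mul]
      rw [Finset.sum_sub_distrib, ← Finset.mul_sum, Finset.sum_sub_distrib, Finset.sum_sub_distrib,
        hsum]
      have : ∑ I, stepDensity (swapBase A D') A ⟨0, hk⟩ (D I) p =
          n + (stepDensity (swapBase A D') A ⟨0, hk⟩ (D 0) p -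
            stepDensity (swapBase A D') A ⟨0, hk⟩ (D' 0) p) := by
        rw [← hsum, ← Finset.add_sum_erase _ _ (Finset.mem_univ (0 : Fin n)),
          ← Finset.add_sum_erase _ _ (Finset.mem_univ (0 : Fin n)),
          Finset.sum_congr rfl fun I hI => by rw [hD I (Finset.ne_of_mem_erase hI)]]
        ring
      rw [this]
      simp
      field_simp
    rw [key]
    -- At step 0 the increment is (u - v)/n without the factor w, so the bound is taken at w = 1.
    -- Its length 2(r - 1)/n fits because 1 + w ≥ 2 and r ≥ 1.
    have := sub_mul_mem_Icc_of_le_mul le_rfl hr1 hu hv huv hvu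
    rw [one_mul, one_mul] at this
    constructor
    · rw [← neg_div]; gcongr; linarith [this.1]
    · rw [← neg_div, ← add_div]; gcongr
      have : (r - 1) * 2 * 1 ≤ (r - 1) * (1 + w) * r := by
        gcongr; linarith
      linarith [‹_ ∈ Set.Icc _ _›.2]
  · have hD0 : D ⟨k, hk⟩ = D' ⟨k, hk⟩ := hD _ hk0
    let f := reportDensity (swapBase A D') A (D' ∘ Equiv.swap 0 ⟨k, hk⟩) k hk.le
    -- The swap moves the element on which D and D' differ to position k, which the first k reports
    -- do not read.
    have hf : reportDensity (swapBase A D') A (D ∘ Equiv.swap 0 ⟨k, hk⟩) k hk.le = f := by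
      refine reportDensity_congr k hk.le fun j hj => ?_
      by_cases hj0 : j = 0
      · simp [hj0, hD0]
      · have : Equiv.swap 0 ⟨k, hk⟩ j = j :=
          Equiv.swap_apply_of_ne_of_ne hj0 (by rintro rfl; simp at hj)
        simp [this, hD j hj0]
    have hfle := reportDensity_swapBase_le ha hA D' (D' ∘ Equiv.swap 0 ⟨k, hk⟩) k hk.le
      fun j hj0 hj => by
        have : Equiv.swap 0 ⟨k, hk⟩ j = j :=
          Equiv.swap_apply_of_ne_of_ne hj0 (by rintro rfl; simp at hj)
        simp [this]
    refine ⟨fun s => f s / n * (w - w * r), ?_⟩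
    refine Measure.ae_ae_of_ae_compProd
      (p := fun p => swapDeviation A D D' w (k + 1) hk (snocReport S hk p) -
          swapDeviation A D D' w k hk.le p.1 ∈
        Set.Icc (f p.1 / n * (w - w * r)) (f p.1 / n * (w - w * r) + (r - 1) * (1 + w) * r / n)) ?_
    filter_upwards [stepDensity_swapBase_self (A := A) D' hk0,
      stepDensity_swapBase_le hA D' ⟨k, hk⟩ (D 0), stepDensity_swapBase_le hA D' ⟨k, hk⟩ (D' 0),
      stepDensity_swapBase_le_mul hA D' ⟨k, hk⟩ (D 0) (D' 0),
      stepDensity_swapBase_le_mul hA D' ⟨k, hk⟩ (D' 0) (D 0),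
      Measure.ae_compProd_of_ae_fst (swapBase A D' ⟨k, hk⟩ ())
        (measurableSet_le (by fun_prop) (by fun_prop)) hfle] with p hself hu hv huv hvu hfp
    rw [swapDeviation_snoc_sub, Finset.sum_eq_single ⟨k, hk⟩]
    · have h1 : ∀ z : Fin n → X, (z ∘ Equiv.swap 0 ⟨k, hk⟩) ⟨k, hk⟩ = z 0 := fun z => by simp
      rw [h1, h1, hf]
      have hmem := sub_mul_mem_Icc_of_le_mul hw hwa hu hv huv hvu
      set u := stepDensity (swapBase A D') A ⟨k, hk⟩ (D 0) p
      set v := stepDensity (swapBase A D') A ⟨k, hk⟩ (D' 0) p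
      have hf0 : 0 ≤ f p.1 / n := div_nonneg (reportDensity_nonneg _ _ _ _) hn.le
      have hfr : f p.1 / n ≤ r / n := by gcongr
      have e1 : (n : ℝ)⁻¹ * (f p.1 * (u - 1) - w * (f p.1 * (v - 1))) =
          f p.1 / n * (u - w * v + (w - 1)) := by ring
      change (n : ℝ)⁻¹ * (f p.1 * (u - 1) - w * (f p.1 * (v - 1))) ∈ _
      rw [e1]
      constructor
      · gcongr; linarith [hmem.1]
      · have e2 : (r - 1) * (1 + w) * r / n = r / n * ((r - 1) * (1 + w)) := by ring
        have e3 : f p.1 / n * ((r - 1) * (1 + w)) ≤ r / n * ((r - 1) * (1 + w)) :=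
          mul_le_mul_of_nonneg_right hfr (mul_nonneg (by linarith) (by linarith))
        rw [e2]
        refine le_trans ?_ (add_le_add_right e3 _)
        rw [← mul_add]
        exact mul_le_mul_of_nonneg_left (by linarith [hmem.2]) hf0
    · intro I _ hI
      have h1 : Equiv.swap 0 I ⟨k, hk⟩ = ⟨k, hk⟩ := Equiv.swap_apply_of_ne_of_ne hk0 (Ne.symm hI)
      simp only [Function.comp_apply, h1, hD0, hself]
      simp
    · simp

theorem lintegral_exp_swapDeviation_le (ha : 0 ≤ a) (hA : IsPureDPFamily a A) {D D' : Fin n → X}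
    (hD : ∀ i, i ≠ 0 → D i = D' i) {w : ℝ} (hw : 1 ≤ w) (hwa : w ≤ Real.exp a) (θ : ℝ)
    (k : ℕ) (hk : k ≤ n) :
    ∫⁻ s, ENNReal.ofReal (Real.exp (θ * swapDeviation A D D' w k hk s))
        ∂baseLaw (swapBase A D') k hk ≤
      ENNReal.ofReal (Real.exp
        (k * (θ ^ 2 * ((Real.exp a - 1) * (1 + w) * Real.exp a / n) ^ 2 / 8))) := by
  induction k with
  | zero => simp [swapDeviation_zero]
  | succ k ih =>
    have hk' : k < n := hk
    have : IsMarkovKernel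
      (swapBase A D' ⟨k, hk⟩ () : Kernel (ReportPrefix S k hk'.le) (S ⟨k, hk⟩)) :=
      isMarkovKernel_swapBase A D' ⟨k, hk⟩ ()
    obtain ⟨lo, hlo⟩ := swapDeviation_snoc_sub_mem_Icc ha hA hD hw hwa hk'
    have h1 := lintegral_exp_step_le (θ := θ)
      (V := fun p => swapDeviation A D D' w (k + 1) hk (snocReport S hk p))
      (measurable_swapDeviation D D' w k hk'.le)
      (by fun_prop) lo hlo (integral_swapDeviation_snoc_sub hA D D' w hk')
    rw [lintegral_reportLaw_succ _ _ hk (by fun_prop)]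
    refine h1.trans ?_
    refine (mul_le_mul_right (ih hk'.le) _).trans ?_
    rw [← ENNReal.ofReal_mul (Real.exp_nonneg _), ← Real.exp_add]
    refine ENNReal.ofReal_le_ofReal (Real.exp_le_exp.2 (le_of_eq ?_))
    push_cast
    ring

/-- The left side is the integral of Z - (w - 1) over `E`, with Z the final deviation. The
inequality y ≤ e^{y-1} at y = θ(Z - (w - 1)) passes to the exponential moment, and positivity allows
`E` to be enlarged to the whole space. -/
theorem sum_reportLaw_swap_sub_le (ha : 0 ≤ a) (hA : IsPureDPFamily a A) {D D' : Fin n → X}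
    (hD : ∀ i, i ≠ 0 → D i = D' i) {w : ℝ} (hw : 1 ≤ w) (hwa : w ≤ Real.exp a) {θ : ℝ}
    (hθ : 0 < θ) {E : Set (ReportPrefix S n le_rfl)} (hE : MeasurableSet E) :
    (n : ℝ)⁻¹ * ∑ I, (reportLaw A (D ∘ Equiv.swap 0 I) n le_rfl).real E -
        w * ((n : ℝ)⁻¹ * ∑ I, (reportLaw A (D' ∘ Equiv.swap 0 I) n le_rfl).real E) ≤
      (Real.exp 1 * θ)⁻¹ * Real.exp (-θ * (w - 1) +
        n * (θ ^ 2 * ((Real.exp a - 1) * (1 + w) * Real.exp a / n) ^ 2 / 8)) := by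
  have hi := fun z => integrable_reportDensity (hA.ac_swapBase D') z n le_rfl
  have h1 : (n : ℝ)⁻¹ * ∑ I, (reportLaw A (D ∘ Equiv.swap 0 I) n le_rfl).real E -
        w * ((n : ℝ)⁻¹ * ∑ I, (reportLaw A (D' ∘ Equiv.swap 0 I) n le_rfl).real E) =
      ∫ s in E, (swapDeviation A D D' w n le_rfl s - (w - 1))
        ∂baseLaw (swapBase A D') n le_rfl := by
    simp only [swapDeviation, add_sub_cancel_right]
    rw [integral_const_mul, integral_finsetSum]
    swap
    · intro I _
      exact ((hi _).sub ((hi _).const_mul w)).integrableOn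
    simp_rw [fun z => reportLaw_real_eq_reportDensity (hA.ac_swapBase D') z n le_rfl hE]
    rw [mul_left_comm, ← mul_sub, Finset.mul_sum, ← Finset.sum_sub_distrib]
    congr 1
    refine Finset.sum_congr rfl fun I _ => ?_
    rw [integral_sub (hi _).integrableOn ((hi _).const_mul w).integrableOn, integral_const_mul]
  have hlin := lintegral_exp_swapDeviation_le ha hA hD hw hwa θ n le_rfl
  set N := baseLaw (swapBase A D') n le_rfl
  have hint : Integrable (fun s => Real.exp (θ * swapDeviation A D D' w n le_rfl s)) N := by
    refine ⟨(by fun_prop : Measurable _).aestronglyMeasurable, ?_⟩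
    rw [hasFiniteIntegral_iff_ofReal (Filter.Eventually.of_forall fun _ => Real.exp_nonneg _)]
    exact hlin.trans_lt ENNReal.ofReal_lt_top
  have hexp : ∫ s, Real.exp (θ * swapDeviation A D D' w n le_rfl s) ∂N ≤
      Real.exp (n * (θ ^ 2 * ((Real.exp a - 1) * (1 + w) * Real.exp a / n) ^ 2 / 8)) := by
    rw [← ofReal_integral_eq_lintegral_ofReal hint
      (Filter.Eventually.of_forall fun _ => Real.exp_nonneg _)] at hlin
    exact (ENNReal.ofReal_le_ofReal_iff (Real.exp_nonneg _)).1 hlin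
  have hpt : ∀ x : ℝ, x - (w - 1) ≤
      (Real.exp 1 * θ)⁻¹ * Real.exp (-θ * (w - 1)) * Real.exp (θ * x) := fun x => by
    have := Real.add_one_le_exp (θ * (x - (w - 1)) - 1)
    rw [mul_assoc, ← Real.exp_add, inv_mul_eq_div, le_div_iff₀ (by positivity)]
    have e : -θ * (w - 1) + θ * x = (θ * (x - (w - 1)) - 1) + 1 := by ring
    rw [e, Real.exp_add]
    nlinarith [Real.exp_pos 1]
  have hsub : Integrable (fun s => swapDeviation A D D' w n le_rfl s - (w - 1)) N := by
    simp only [swapDeviation, add_sub_cancel_right]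
    exact (integrable_finsetSum _ fun I _ => (hi _).sub ((hi _).const_mul w)).const_mul _
  rw [h1]
  calc ∫ s in E, (swapDeviation A D D' w n le_rfl s - (w - 1)) ∂N
      ≤ ∫ s in E, (Real.exp 1 * θ)⁻¹ * Real.exp (-θ * (w - 1)) *
          Real.exp (θ * swapDeviation A D D' w n le_rfl s) ∂N :=
        setIntegral_mono_on hsub.integrableOn (hint.const_mul _).integrableOn hE
          fun s _ => hpt _
    _ ≤ ∫ s, (Real.exp 1 * θ)⁻¹ * Real.exp (-θ * (w - 1)) *
          Real.exp (θ * swapDeviation A D D' w n le_rfl s) ∂N :=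
        setIntegral_le_integral (hint.const_mul _)
          (Filter.Eventually.of_forall fun s => by positivity)
    _ ≤ _ := by
        rw [integral_const_mul, Real.exp_add, ← mul_assoc]
        gcongr

end Swap

/-! ### Amplification for pure randomizers -/

/-- With w = e^ε and C as in the proof, the exponent -θ(w - 1) + θ²C/8 is minimal at θ = 4(w - 1)/C,
with value -2(w - 1)²/C. The square-root term in the hypothesis on ε brings this below -log(1/δ),
and the other term makes the prefactor at most one. Both use 1 + w ≤ 2r and ε ≤ w - 1. -/
theorem hockeyStick_exponent_bound {a ε δ m : ℝ} (hm : 0 < m) (hδ : δ ∈ Set.Ioo (0 : ℝ) 1)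
    (hεa : ε < a)
    (hε : ((Real.exp a - 1) * Real.exp a ^ 2) ^ 2 / (2 * m) +
      (Real.exp a - 1) * Real.exp a ^ 2 * √(2 * Real.log (1 / δ) / m) ≤ ε) (ha : 0 < a) :
    ∃ θ : ℝ, 0 < θ ∧ (Real.exp 1 * θ)⁻¹ * Real.exp (-θ * (Real.exp ε - 1) +
        m * (θ ^ 2 * ((Real.exp a - 1) * (1 + Real.exp ε) * Real.exp a / m) ^ 2 / 8)) ≤ δ := by
  obtain ⟨hδ0, hδ1⟩ := hδ
  set r := Real.exp a with hr
  set w := Real.exp ε with hw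
  set L := Real.log (1 / δ) with hL
  have hr1 : 1 < r := Real.one_lt_exp_iff.2 ha
  have hL0 : 0 ≤ L := Real.log_nonneg (by rw [le_div_iff₀ hδ0]; linarith)
  set b := (r - 1) * r with hb
  have hb0 : 0 < b := mul_pos (by linarith) (by linarith)
  have hcb : (r - 1) * r ^ 2 = b * r := by rw [hb]; ring
  rw [hcb] at hε
  have hc0 : 0 < b * r := mul_pos hb0 (by linarith)
  have hε1 : (b * r) ^ 2 / (2 * m) ≤ ε := le_trans (by
    have : 0 ≤ b * r * √(2 * L / m) := by positivity
    linarith) hε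
  have hε2 : b * r * √(2 * L / m) ≤ ε := le_trans (by
    have : 0 ≤ (b * r) ^ 2 / (2 * m) := by positivity
    linarith) hε
  have hε0 : 0 < ε := lt_of_lt_of_le (by positivity) hε1
  have hwε : ε ≤ w - 1 := by linarith [Real.add_one_le_exp ε]
  have hwr : w ≤ r := Real.exp_le_exp.2 hεa.le
  have hw1 : 0 < w - 1 := by linarith
  set C := (b * (1 + w)) ^ 2 / m with hC
  have hC0 : 0 < C := by positivity
  have hCle : C ≤ 4 * (b * r) ^ 2 / m := by
    rw [hC]
    gcongr
    have : b * (1 + w) ≤ b * (2 * r) := by gcongr; linarith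
    calc (b * (1 + w)) ^ 2 ≤ (b * (2 * r)) ^ 2 := by gcongr
      _ = 4 * (b * r) ^ 2 := by ring
  have hsq : (b * r) ^ 2 * (2 * L / m) ≤ ε ^ 2 := by
    calc (b * r) ^ 2 * (2 * L / m) = (b * r * √(2 * L / m)) ^ 2 := by
          rw [mul_pow (b * r), Real.sq_sqrt (by positivity)]
      _ ≤ ε ^ 2 := by gcongr
  refine ⟨4 * (w - 1) / C, by positivity, ?_⟩
  have hexp : -(4 * (w - 1) / C) * (w - 1) +
      m * ((4 * (w - 1) / C) ^ 2 * ((r - 1) * (1 + w) * r / m) ^ 2 / 8) = -(2 * (w - 1) ^ 2 / C) := by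
    have : ((r - 1) * (1 + w) * r / m) ^ 2 = C / m := by rw [hC, hb]; field_simp
    rw [this]
    field_simp
    ring
  rw [hexp]
  have h1 : L ≤ 2 * (w - 1) ^ 2 / C := by
    rw [le_div_iff₀ hC0]
    calc L * C ≤ L * (4 * (b * r) ^ 2 / m) := by gcongr
      _ = 2 * ((b * r) ^ 2 * (2 * L / m)) := by ring
      _ ≤ 2 * ε ^ 2 := by gcongr
      _ ≤ 2 * (w - 1) ^ 2 := by gcongr
  have h2 : (Real.exp 1 * (4 * (w - 1) / C))⁻¹ ≤ 1 := by
    refine inv_le_one_of_one_le₀ ?_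
    have he : 2 ≤ Real.exp 1 := by linarith [Real.add_one_le_exp (1 : ℝ)]
    have h3 : C ≤ 8 * (w - 1) := by
      calc C ≤ 4 * (b * r) ^ 2 / m := hCle
        _ = 8 * ((b * r) ^ 2 / (2 * m)) := by field_simp; norm_num
        _ ≤ 8 * (w - 1) := by linarith
    have h4 : 1 ≤ 2 * (4 * (w - 1) / C) := by
      rw [← mul_div_assoc, le_div_iff₀ hC0]; linarith
    exact h4.trans (by gcongr)
  calc _ ≤ 1 * Real.exp (-L) := by gcongr
    _ = δ := by rw [hL, one_div, Real.log_inv, neg_neg, Real.exp_log hδ0, one_mul]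

theorem epsCentral_nonneg {a ε₁ δ : ℝ} (hε₁ : 0 ≤ ε₁) : 0 ≤ epsCentral a ε₁ δ := by
  unfold epsCentral; positivity

/-- Since √(1 - 1/n) ≥ 1 - 1/n, the two bounds on ε₁ force √L < 1/n. With L(r + 1) > 2 this yields r
+ 1 > 2n² ≥ 8. Then ε₁² ≥ L/n ≥ 1/r², and the remaining powers of r dominate. -/
theorem le_half_sq_mul_sq {n r L ε₁ : ℝ} (hn : 2 ≤ n) (hL0 : 0 < L) (hr1 : 1 ≤ r)
    (hε₁ : √((1 - 1 / n) * (1 / n)) + √(L / n) ≤ ε₁) (h1 : ε₁ < √(1 / n))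
    (h2 : 2 < L * (r + 1)) : r ≤ ((r - 1) * r ^ 2) ^ 2 * ε₁ ^ 2 / 2 := by
  have hn0 : 0 < n := by linarith
  have hs1 : 1 - 1 / n ≤ √(1 - 1 / n) := by
    have h0 : 0 ≤ 1 - 1 / n := by rw [sub_nonneg, div_le_one hn0]; linarith
    have h3 : 0 ≤ 1 / n := by positivity
    refine Real.le_sqrt_of_sq_le ?_
    rw [sq]
    exact mul_le_of_le_one_left h0 (by linarith)
  have hs2 : √L < 1 / n := by
    rw [Real.sqrt_mul' _ (by positivity), ← mul_one_div L, Real.sqrt_mul hL0.le, ← add_mul] at hε₁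
    have h3 : √(1 - 1 / n) + √L < 1 := by
      by_contra hcon
      exact (h1.trans_le (le_mul_of_one_le_left (Real.sqrt_nonneg _) (not_lt.1 hcon))).not_ge hε₁
    linarith
  have hLn : L * n ^ 2 < 1 := by
    have : L < (1 / n) ^ 2 := by
      rw [← Real.sq_sqrt hL0.le]; gcongr
    rwa [div_pow, one_pow, lt_div_iff₀ (by positivity)] at this
  have hrn : 2 * n ^ 2 < r + 1 := by
    have h3 : L * (2 * n ^ 2) < L * (r + 1) := by linarith
    exact lt_of_mul_lt_mul_left h3 hL0.le
  have hn2 : 2 * n ≤ n ^ 2 := by rw [sq]; gcongr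
  have hr7 : 7 < r := by linarith
  have hLe : L / n ≤ ε₁ ^ 2 := by
    rw [← Real.sq_sqrt (by positivity : 0 ≤ L / n)]
    gcongr
    exact le_trans (le_add_of_nonneg_left (Real.sqrt_nonneg _)) hε₁
  have h11 : 1 / r ^ 2 ≤ ε₁ ^ 2 := by
    refine le_trans ?_ hLe
    rw [div_le_div_iff₀ (by positivity) hn0]
    have hnr : n ≤ r := by linarith
    have hLr : r * 2 ≤ r * (L * (r + 1)) := by gcongr
    have hLr' : 0 ≤ L * r * (r - 1) := mul_nonneg (by positivity) (by linarith)
    linarith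
  calc r ≤ (6 * r) ^ 2 / 2 := by nlinarith
    _ ≤ ((r - 1) * r) ^ 2 / 2 := by gcongr; linarith
    _ = ((r - 1) * r ^ 2) ^ 2 * (1 / r ^ 2) / 2 := by field_simp
    _ ≤ _ := by gcongr

/-- If ε(a) ≥ a, the pure bound suffices; if ε₁ ≥ 1/√n, `hadv` applies at ε(a). Otherwise the two
one-sided bounds give p - q ≤ (r - 1)/(r + 1), which δ₂ absorbs when 1 - δ₂ ≤ 2/(r + 1). In the
remaining case log(1/δ₂) ≥ 1 - δ₂ and `le_half_sq_mul_sq` force ε(a) ≥ r > a, a contradiction. -/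
theorem le_exp_epsCentral_mul_add {n : ℕ} (hn : 2 ≤ n) {a δ δ₂ ε₁ p q : ℝ}
    (hδ : δ ∈ Set.Ioo (0 : ℝ) 1) (hδ₂ : δ₂ ∈ Set.Ioo (0 : ℝ) 1)
    (hε₁ : √((1 - 1 / (n : ℝ)) * (1 / n)) + √(Real.log (1 / δ₂) / n) ≤ ε₁)
    (ha : 0 ≤ a) (hq0 : 0 ≤ q)
    (hpq : p ≤ Real.exp a * q) (hqp : 1 - q ≤ Real.exp a * (1 - p))
    (hadv : ∀ ε < a, ((Real.exp a - 1) * Real.exp a ^ 2) ^ 2 / (2 * n) +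
      (Real.exp a - 1) * Real.exp a ^ 2 * √(2 * Real.log (1 / δ) / n) ≤ ε →
      p ≤ Real.exp ε * q + δ) :
    p ≤ Real.exp (epsCentral a ε₁ δ) * q + (δ + δ₂) := by
  obtain ⟨hδ0, hδ1⟩ := hδ
  obtain ⟨hδ₂0, hδ₂1⟩ := hδ₂
  have hn2 : (2 : ℝ) ≤ n := by exact_mod_cast hn
  have hn0 : (0 : ℝ) < n := by linarith
  have hε₁0 : 0 ≤ ε₁ := le_trans (by positivity) hε₁
  rcases le_or_gt a (epsCentral a ε₁ δ) with hE | hE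
  · have : Real.exp a * q ≤ Real.exp (epsCentral a ε₁ δ) * q := by gcongr
    linarith
  have hE0 := epsCentral_nonneg (a := a) (δ := δ) hε₁0
  set r := Real.exp a with hr
  have hr1 : 1 ≤ r := Real.one_le_exp ha
  set c := (r - 1) * r ^ 2 with hc
  have hc0 : 0 ≤ c := mul_nonneg (by linarith) (by positivity)
  have hL : 0 ≤ Real.log (1 / δ) := Real.log_nonneg (by rw [le_div_iff₀ hδ0]; linarith)
  have h4 : Real.exp (4 * a) = r ^ 4 := by rw [hr, ← Real.exp_nat_mul]; norm_num
  have hEeq : epsCentral a ε₁ δ = c ^ 2 * ε₁ ^ 2 / 2 + ε₁ * (c * √(2 * Real.log (1 / δ))) := by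
    unfold epsCentral
    rw [h4, show 2 * (r - 1) ^ 2 * r ^ 4 * Real.log (1 / δ) = c ^ 2 * (2 * Real.log (1 / δ)) by
      rw [hc]; ring, Real.sqrt_mul (sq_nonneg c), Real.sqrt_sq hc0, hc]
    ring
  rcases le_or_gt (√(1 / n)) ε₁ with h1 | h1
  · have := hadv _ hE ?_
    · linarith
    rw [hEeq]
    refine add_le_add ?_ ?_
    · have : 1 / (n : ℝ) ≤ ε₁ ^ 2 := by
        rw [← Real.sq_sqrt (by positivity : (0 : ℝ) ≤ 1 / n)]; gcongr
      calc c ^ 2 / (2 * n) = c ^ 2 * (1 / n) / 2 := by field_simp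
        _ ≤ _ := by gcongr
    · rw [show 2 * Real.log (1 / δ) / (n : ℝ) = 1 / n * (2 * Real.log (1 / δ)) by ring,
        Real.sqrt_mul (by positivity), mul_left_comm]
      gcongr
  · set L := Real.log (1 / δ₂) with hL2
    have hL2' : 1 - δ₂ ≤ L := by
      rw [hL2, one_div, Real.log_inv]; linarith [Real.log_le_sub_one_of_pos hδ₂0]
    rcases le_or_gt (1 - δ₂) (2 / (r + 1)) with h2 | h2
    · have h3 : p - q ≤ 1 - 2 / (r + 1) := by
        rw [one_sub_div (by linarith), le_div_iff₀ (by linarith)]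
        linarith
      have h5 : 1 * q ≤ Real.exp (epsCentral a ε₁ δ) * q := by
        gcongr; exact Real.one_le_exp hE0
      linarith
    · exfalso
      have h10 : 2 < L * (r + 1) := by
        rw [div_lt_iff₀ (by linarith)] at h2
        exact h2.trans_le (mul_le_mul_of_nonneg_right hL2' (by linarith))
      have h12 := le_half_sq_mul_sq hn2 (by linarith) hr1 hε₁ h1 h10
      have : 0 ≤ ε₁ * (c * √(2 * Real.log (1 / δ))) := by positivity
      linarith [Real.add_one_le_exp a]

section PureAmplification

variable {n : ℕ} [NeZero n] {X : Type*} {S : Fin n → Type*} [∀ k, MeasurableSpace (S k)]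
  {A : AdaptiveRandomizers X S} [∀ k x, IsMarkovKernel (A k x)] {a : ℝ}

/-- For fixed I the two swapped datasets differ only at position I, so a single step costs the
factor e^a. -/
theorem swapFixMechanism_real_le (hA : IsPureDPFamily a A) (ℓ : Fin n → ℕ)
    {D D' : Fin n → X} (hD : ∀ i, i ≠ 0 → D i = D' i)
    {E : Set (∀ i : Fin n, ∀ k : Block ℓ i, S k.1)} (hE : MeasurableSet E) :
    (swapFixMechanism A ℓ D).real E ≤ Real.exp a * (swapFixMechanism A ℓ D').real E := by
  rw [swapFixMechanism_real A ℓ D hE, swapFixMechanism_real A ℓ D' hE, mul_left_comm,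
    Finset.mul_sum _ _ (Real.exp a)]
  gcongr with I
  have h := reportLaw_le_smul hA (x := D ∘ Equiv.swap 0 I) (z := D' ∘ Equiv.swap 0 I) I
    (fun j hj => hD _ fun h0 => hj ((Equiv.swap 0 I).injective (by simpa using h0))) n le_rfl
  rw [if_pos I.isLt] at h
  have h1 := ENNReal.toReal_mono (ENNReal.mul_ne_top ENNReal.ofReal_ne_top (measure_ne_top _ _))
    (h ((fun (s : ReportPrefix S n le_rfl) (i : Fin n) (k : Block ℓ i) => (s k.1 : S k.1)) ⁻¹' E))
  rwa [ENNReal.toReal_mul, ENNReal.toReal_ofReal (Real.exp_nonneg a)] at h1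

instance isProbabilityMeasure_swapFixMechanism (ℓ : Fin n → ℕ) (D : Fin n → X) :
    IsProbabilityMeasure (swapFixMechanism A ℓ D) := by
  refine ⟨?_⟩
  simp only [swapFixMechanism, fixMechanism, Measure.coe_finsetSum, Finset.sum_apply,
    Measure.smul_apply, smul_eq_mul]
  simp_rw [Measure.map_apply (measurable_blocks ℓ) MeasurableSet.univ, Set.preimage_univ,
    measure_univ]
  have := inv_card_mul_sum_const (J := Fin n) 1
  rwa [Fintype.card_fin, Finset.mul_sum] at this

theorem isDPAtFirst_swapFixMechanism (hn : 2 ≤ n) (ha : 0 ≤ a) (hA : IsPureDPFamily a A)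
    (ℓ : Fin n → ℕ) {δ δ₂ ε₁ : ℝ} (hδ : δ ∈ Set.Ioo (0 : ℝ) 1) (hδ₂ : δ₂ ∈ Set.Ioo (0 : ℝ) 1)
    (hε₁ : √((1 - 1 / (n : ℝ)) * (1 / n)) + √(Real.log (1 / δ₂) / n) ≤ ε₁) :
    IsDPAtFirst (epsCentral a ε₁ δ) (δ + δ₂) (swapFixMechanism A ℓ) := by
  intro D D' hD E hE
  have hn0 : (0 : ℝ) < n := by exact_mod_cast NeZero.pos n
  refine le_exp_epsCentral_mul_add hn hδ hδ₂ hε₁ ha measureReal_nonneg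
    (swapFixMechanism_real_le hA ℓ hD hE) ?_ ?_
  -- The second one-sided bound is the first for the complement, with `D` and `D'` exchanged.
  · rw [← probReal_compl_eq_one_sub hE, ← probReal_compl_eq_one_sub hE]
    exact swapFixMechanism_real_le hA ℓ (fun i hi => (hD i hi).symm) hE.compl
  · intro ε hεa hε
    have hr1 : 1 ≤ Real.exp a := Real.one_le_exp ha
    have hε0 : 0 ≤ ε := le_trans (add_nonneg (by positivity)
      (mul_nonneg (mul_nonneg (by linarith) (by positivity)) (Real.sqrt_nonneg _))) hε
    obtain ⟨θ, hθ, hle⟩ := hockeyStick_exponent_bound hn0 hδ hεa hε (by linarith)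
    have h := sum_reportLaw_swap_sub_le ha hA hD (Real.one_le_exp hε0)
      (Real.exp_le_exp.2 hεa.le) hθ (measurable_blocks ℓ hE)
    rw [← swapFixMechanism_real A ℓ D hE, ← swapFixMechanism_real A ℓ D' hE] at h
    linarith

end PureAmplification

/-! ### Approximate randomizers are close to pure ones -/

section ClippedKernel

variable {α β J : Type*} [MeasurableSpace α] [MeasurableSpace β] [Fintype J]

/-- The density of `K j` relative to the average kernel, clipped to `[R⁻¹, R]`. -/
noncomputable def clippedDensity (N : Measure α) (K : J → Kernel α β) (R : ENNReal) (j : J)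
    (p : α × β) : ENNReal :=
  max R⁻¹ (min (ENNReal.ofReal (condDensity N (avgKernel K) (K j) p)) R)

@[fun_prop]
theorem measurable_clippedDensity (N : Measure α) (K : J → Kernel α β) (R : ENNReal) (j : J) :
    Measurable (clippedDensity N K R j) := by
  unfold clippedDensity; fun_prop

/-- The total mass of the clipped density. -/
noncomputable def clippedMass (N : Measure α) (K : J → Kernel α β) (R : ENNReal) (j : J)
    (s : α) : ENNReal := ∫⁻ y, clippedDensity N K R j (s, y) ∂avgKernel K s

variable {N : Measure α} {K : J → Kernel α β} {R : ENNReal}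

theorem inv_le_clippedDensity (j : J) (p : α × β) : R⁻¹ ≤ clippedDensity N K R j p := le_max_left _ _

theorem clippedDensity_le (hR : 1 ≤ R) (j : J) (p : α × β) : clippedDensity N K R j p ≤ R :=
  max_le ((ENNReal.inv_le_one.2 hR).trans hR) (min_le_right _ _)

variable [Nonempty J]

theorem avgKernel_apply_le_mul_add {τ : ENNReal}
    (h : ∀ s i j E, MeasurableSet E → K i s E ≤ R * K j s E + τ) (s : α) (j : J) {E : Set β}
    (hE : MeasurableSet E) : avgKernel K s E ≤ R * K j s E + τ := by
  rw [avgKernel_apply', ← inv_card_mul_sum_const (J := J) (R * K j s E + τ)]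
  gcongr with i
  exact h s i j E hE

/-- Against the average kernel, an approximately private family is approximately private. -/
theorem apply_le_mul_avgKernel_add {τ : ENNReal}
    (h : ∀ s i j E, MeasurableSet E → K i s E ≤ R * K j s E + τ) (s : α) (j : J) {E : Set β}
    (hE : MeasurableSet E) : K j s E ≤ R * avgKernel K s E + τ := by
  calc K j s E = (Fintype.card J : ENNReal)⁻¹ * ∑ _i : J, K j s E :=
        (inv_card_mul_sum_const _).symm
    _ ≤ (Fintype.card J : ENNReal)⁻¹ * ∑ i, (R * K i s E + τ) := by
        gcongr with i
        exact h s j i E hE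
    _ = R * avgKernel K s E + τ := by
        rw [Finset.sum_add_distrib, mul_add, inv_card_mul_sum_const, ← Finset.mul_sum,
          mul_left_comm, avgKernel_apply']

variable [∀ j, IsMarkovKernel (K j)]

@[fun_prop]
theorem measurable_clippedMass (j : J) : Measurable (clippedMass N K R j) :=
  Measurable.lintegral_kernel_prod_right' (f := clippedDensity N K R j) (by fun_prop)

/-- The kernel whose density relative to the average kernel is the normalized clipped density. -/
noncomputable def clippedKernel (N : Measure α) (K : J → Kernel α β) [∀ j, IsMarkovKernel (K j)]
    (R : ENNReal) (j : J) : Kernel α β :=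
  Kernel.withDensity (avgKernel K)
    fun s y => clippedDensity N K R j (s, y) * (clippedMass N K R j s)⁻¹

theorem measurable_clippedDensity_mul_inv (j : J) : Measurable (Function.uncurry
    fun s y => clippedDensity N K R j (s, y) * (clippedMass N K R j s)⁻¹) := by
  have : Measurable fun p : α × β => clippedDensity N K R j p * (clippedMass N K R j p.1)⁻¹ := by
    fun_prop
  exact this

theorem lintegral_clippedKernel (j : J) (s : α) {φ : β → ENNReal} (hφ : Measurable φ) :
    ∫⁻ y, φ y ∂clippedKernel N K R j s =
      (clippedMass N K R j s)⁻¹ * ∫⁻ y, clippedDensity N K R j (s, y) * φ y ∂avgKernel K s := by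
  rw [clippedKernel, Kernel.lintegral_withDensity _ (measurable_clippedDensity_mul_inv j) s hφ,
    ← lintegral_const_mul _ (by fun_prop)]
  refine lintegral_congr fun y => ?_
  ring

theorem inv_le_clippedMass (j : J) (s : α) : R⁻¹ ≤ clippedMass N K R j s := by
  calc R⁻¹ = ∫⁻ _, R⁻¹ ∂avgKernel K s := by simp
    _ ≤ _ := lintegral_mono fun y => inv_le_clippedDensity j _

theorem clippedMass_le (hR : 1 ≤ R) (j : J) (s : α) : clippedMass N K R j s ≤ R := by
  calc _ ≤ ∫⁻ _, R ∂avgKernel K s := lintegral_mono fun y => clippedDensity_le hR j _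
    _ = R := by simp

theorem isMarkovKernel_clippedKernel (hR : 1 ≤ R) (hR' : R ≠ ⊤) (j : J) :
    IsMarkovKernel (clippedKernel N K R j) where
  isProbabilityMeasure s := ⟨by
    rw [← lintegral_one, lintegral_clippedKernel j s measurable_const]
    simp only [mul_one]
    exact ENNReal.inv_mul_cancel
      ((ENNReal.inv_pos.2 hR').trans_le (inv_le_clippedMass j s)).ne'
      ((clippedMass_le hR j s).trans_lt hR'.lt_top).ne⟩

/-- Clipped densities and their masses all lie in [R⁻¹, R]; the density ratio costs R² and the ratio
of normalizations another R². -/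
theorem clippedKernel_le_smul (hR : 1 ≤ R) (hR' : R ≠ ⊤) (i j : J) (s : α) :
    clippedKernel N K R i s ≤ R ^ 4 • clippedKernel N K R j s := by
  have hR0 : R ≠ 0 := (zero_lt_one.trans_le hR).ne'
  refine Measure.le_iff.2 fun E hE => ?_
  rw [Measure.smul_apply, smul_eq_mul, clippedKernel, clippedKernel,
    Kernel.withDensity_apply' _ (measurable_clippedDensity_mul_inv i),
    Kernel.withDensity_apply' _ (measurable_clippedDensity_mul_inv j),
    ← lintegral_const_mul _ (by fun_prop)]
  refine lintegral_mono fun y => ?_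
  calc clippedDensity N K R i (s, y) * (clippedMass N K R i s)⁻¹
      ≤ R * R := by
        gcongr
        · exact clippedDensity_le hR i _
        · exact ENNReal.inv_le_iff_inv_le.1 (inv_le_clippedMass i s)
    _ = R ^ 4 * (R⁻¹ * R⁻¹) := by
        rw [show R ^ 4 * (R⁻¹ * R⁻¹) = R * R * (R * R⁻¹) * (R * R⁻¹) by ring,
          ENNReal.mul_inv_cancel hR0 hR', mul_one, mul_one]
    _ ≤ R ^ 4 * (clippedDensity N K R j (s, y) * (clippedMass N K R j s)⁻¹) := by
        gcongr
        · exact inv_le_clippedDensity j _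
        · exact clippedMass_le hR j s

/-- Integrals of functions with values in `[0, 1]` against `K j` and its clipped version differ by
at most `2 τ`. -/
theorem lintegral_le_lintegral_clippedKernel_add [IsFiniteMeasure N] {τ : ENNReal} (hR : 1 ≤ R)
    (hR' : R ≠ ⊤) (h : ∀ s i j E, MeasurableSet E → K i s E ≤ R * K j s E + τ) (j : J)
    {φ : α × β → ENNReal} (hφ : Measurable φ) (hφ1 : ∀ p, φ p ≤ 1) :
    ∀ᵐ s ∂N, ∫⁻ y, φ (s, y) ∂K j s ≤ ∫⁻ y, φ (s, y) ∂clippedKernel N K R j s + 2 * τ := by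
  have hR0 : R ≠ 0 := (zero_lt_one.trans_le hR).ne'
  have hac := compProd_absolutelyContinuous_avgKernel N K j
  let g := fun p => ENNReal.ofReal (condDensity N (avgKernel K) (K j) p)
  have hg : Measurable g := by fun_prop
  have hG : MeasurableSet {p | R < g p} := measurableSet_lt measurable_const hg
  have hH : MeasurableSet {p | g p < R⁻¹} := measurableSet_lt hg measurable_const
  filter_upwards [lintegral_condDensity_mul hac hφ, lintegral_condDensity hac,
    lintegral_condDensity_mul hac (measurable_one.indicator hG),
    lintegral_condDensity_mul hac (measurable_one.indicator hH)] with s hs hs1 hsG hsH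
  have hind : ∀ {F : Set (α × β)}, MeasurableSet F → ∀ μ : Measure β,
      ∫⁻ y, F.indicator (1 : α × β → ENNReal) (s, y) ∂μ = μ (Prod.mk s ⁻¹' F) := fun hF μ => by
    rw [← lintegral_indicator_one (measurable_prodMk_left hF)]
    rfl
  have hmi : ∀ {F : Set (α × β)}, MeasurableSet F →
      Measurable fun y => F.indicator (1 : α × β → ENNReal) (s, y) := fun hF =>
    (measurable_one.indicator hF).comp measurable_prodMk_left
  rw [hind hG] at hsG
  rw [hind hH] at hsH
  have hGs : MeasurableSet (Prod.mk s ⁻¹' {p | R < g p}) := measurable_prodMk_left hG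
  have hHs : MeasurableSet (Prod.mk s ⁻¹' {p | g p < R⁻¹}) := measurable_prodMk_left hH
  -- The mass of the density above R is exactly the violation of the multiplicative bound on the set
  -- {g > R}, hence at most τ.
  have hexcess : ∫⁻ y, (g (s, y) - R) ∂avgKernel K s ≤ τ := by
    have h1 : ∫⁻ y, (g (s, y) - R) ∂avgKernel K s +
        R * avgKernel K s (Prod.mk s ⁻¹' {p | R < g p}) ≤
        τ + R * avgKernel K s (Prod.mk s ⁻¹' {p | R < g p}) := by
      calc _ = K j s (Prod.mk s ⁻¹' {p | R < g p}) := by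
            rw [← hsG, ← hind hG, ← lintegral_const_mul _
              (hmi hG),
              ← lintegral_add_left (by fun_prop)]
            refine lintegral_congr fun y => ?_
            by_cases hy : R < g (s, y)
            · rw [Set.indicator_of_mem (by exact hy), Pi.one_apply, mul_one, mul_one,
                tsub_add_cancel_of_le hy.le]
            · rw [Set.indicator_of_notMem (by exact hy), mul_zero, mul_zero,
                tsub_eq_zero_of_le (not_lt.1 hy), add_zero]
        _ ≤ _ := (apply_le_mul_avgKernel_add h s j hGs).trans_eq (add_comm _ _)
    exact (ENNReal.add_le_add_iff_right (ENNReal.mul_ne_top hR' (measure_ne_top _ _))).1 h1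
  -- The same on {g < R⁻¹} with the roles of `K j` and the average exchanged; dividing by R ≥ 1 only
  -- shrinks τ.
  have hdefect : ∫⁻ y, (R⁻¹ - g (s, y)) ∂avgKernel K s ≤ τ := by
    have h1 : ∫⁻ y, (R⁻¹ - g (s, y)) ∂avgKernel K s + K j s (Prod.mk s ⁻¹' {p | g p < R⁻¹}) ≤
        τ + K j s (Prod.mk s ⁻¹' {p | g p < R⁻¹}) := by
      calc _ = R⁻¹ * avgKernel K s (Prod.mk s ⁻¹' {p | g p < R⁻¹}) := by
            rw [← hsH, ← hind hH, ← lintegral_const_mul _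
              (hmi hH),
              ← lintegral_add_left (by fun_prop)]
            refine lintegral_congr fun y => ?_
            by_cases hy : g (s, y) < R⁻¹
            · rw [Set.indicator_of_mem (by exact hy), Pi.one_apply, mul_one, mul_one,
                tsub_add_cancel_of_le hy.le]
            · rw [Set.indicator_of_notMem (by exact hy), mul_zero, mul_zero,
                tsub_eq_zero_of_le (not_lt.1 hy), add_zero]
        _ ≤ R⁻¹ * (R * K j s (Prod.mk s ⁻¹' {p | g p < R⁻¹}) + τ) := by
            gcongr; exact avgKernel_apply_le_mul_add h s j hHs
        _ = R⁻¹ * τ + K j s (Prod.mk s ⁻¹' {p | g p < R⁻¹}) := by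
            rw [mul_add, ← mul_assoc, ENNReal.inv_mul_cancel hR0 hR', one_mul, add_comm]
        _ ≤ _ := by
            gcongr
            exact mul_le_of_le_one_left zero_le (ENNReal.inv_le_one.2 hR)
    exact (ENNReal.add_le_add_iff_right (measure_ne_top _ _)).1 h1
  -- Clipping from below adds at most τ to the mass. Undoing the normalization thus costs one τ, and
  -- the excess above R costs the other.
  have hmass : clippedMass N K R j s ≤ 1 + τ := by
    calc clippedMass N K R j s ≤ ∫⁻ y, (g (s, y) + (R⁻¹ - g (s, y))) ∂avgKernel K s :=
          lintegral_mono fun y => by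
            refine max_le ?_ ((min_le_left _ _).trans le_self_add)
            exact le_add_tsub
      _ ≤ 1 + τ := by
          rw [lintegral_add_left (by fun_prop), hs1]
          gcongr
  have hK1 : ∫⁻ y, φ (s, y) ∂clippedKernel N K R j s ≤ 1 := by
    have := isMarkovKernel_clippedKernel (N := N) (K := K) hR hR' j
    calc _ ≤ ∫⁻ _, 1 ∂clippedKernel N K R j s := lintegral_mono fun y => hφ1 _
      _ = 1 := by simp
  have hclip : ∫⁻ y, clippedDensity N K R j (s, y) * φ (s, y) ∂avgKernel K s =
      clippedMass N K R j s * ∫⁻ y, φ (s, y) ∂clippedKernel N K R j s := by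
    rw [lintegral_clippedKernel j s (by fun_prop), ← mul_assoc, ENNReal.mul_inv_cancel
      ((ENNReal.inv_pos.2 hR').trans_le (inv_le_clippedMass j s)).ne'
      ((clippedMass_le hR j s).trans_lt hR'.lt_top).ne, one_mul]
  calc ∫⁻ y, φ (s, y) ∂K j s = ∫⁻ y, g (s, y) * φ (s, y) ∂avgKernel K s := hs.symm
    _ ≤ ∫⁻ y, (clippedDensity N K R j (s, y) * φ (s, y) + (g (s, y) - R)) ∂avgKernel K s := by
        refine lintegral_mono fun y => ?_
        have h1 : g (s, y) ≤ clippedDensity N K R j (s, y) + (g (s, y) - R) := by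
          rcases le_total (g (s, y)) R with hy | hy
          · exact le_trans (le_max_of_le_right (le_min le_rfl hy)) le_self_add
          · calc g (s, y) = R + (g (s, y) - R) := (add_tsub_cancel_of_le hy).symm
              _ ≤ _ := by gcongr; exact le_max_of_le_right (le_min hy le_rfl)
        calc g (s, y) * φ (s, y)
            ≤ (clippedDensity N K R j (s, y) + (g (s, y) - R)) * φ (s, y) := by gcongr
          _ ≤ _ := by
            rw [add_mul]
            gcongr
            exact mul_le_of_le_one_right zero_le (hφ1 _)
    _ = clippedMass N K R j s * ∫⁻ y, φ (s, y) ∂clippedKernel N K R j s +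
          ∫⁻ y, (g (s, y) - R) ∂avgKernel K s := by
        rw [lintegral_add_left (by fun_prop), hclip]
    _ ≤ (1 + τ) * ∫⁻ y, φ (s, y) ∂clippedKernel N K R j s + τ := by gcongr
    _ ≤ ∫⁻ y, φ (s, y) ∂clippedKernel N K R j s + τ * 1 + τ := by
        rw [add_mul, one_mul]; gcongr
    _ = _ := by rw [mul_one, two_mul, add_assoc]

end ClippedKernel

section ApproximateFamily

variable {n : ℕ} {X : Type*} [Fintype X] {S : Fin n → Type*}
  [∀ k, MeasurableSpace (S k)] (A : AdaptiveRandomizers X S)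

/-- The sum of the report laws over all datasets. -/
noncomputable def totalLaw (k : ℕ) (hk : k ≤ n) : Measure (ReportPrefix S k hk) :=
  open Classical in ∑ x : Fin n → X, reportLaw A x k hk

theorem reportLaw_ac_totalLaw (x : Fin n → X) (k : ℕ) (hk : k ≤ n) :
    reportLaw A x k hk ≪ totalLaw A k hk := by
  classical
  refine Measure.absolutelyContinuous_of_le (Measure.le_iff.2 fun E _ => ?_)
  rw [totalLaw, Measure.finsetSum_apply]
  exact Finset.single_le_sum (f := fun x => reportLaw A x k hk E) (fun _ _ => zero_le)
    (Finset.mem_univ x)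

variable [∀ k x, IsMarkovKernel (A k x)]

instance isFiniteMeasure_totalLaw (k : ℕ) (hk : k ≤ n) : IsFiniteMeasure (totalLaw A k hk) := by
  unfold totalLaw; infer_instance

variable [Nonempty X]

/-- The family of clipped randomizers. -/
noncomputable def clippedFamily (R : ENNReal) : AdaptiveRandomizers X S :=
  fun k x => clippedKernel (totalLaw A k k.isLt.le) (A k) R x

variable {A} {R : ENNReal}

theorem lintegral_reportLaw_le_clippedFamily {τ : ENNReal} (hR : 1 ≤ R) (hR' : R ≠ ⊤)
    (h : ∀ k s i j E, MeasurableSet E → A k i s E ≤ R * A k j s E + τ) (x : Fin n → X) (k : ℕ)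
    (hk : k ≤ n) {φ : ReportPrefix S k hk → ENNReal} (hφ : Measurable φ) (hφ1 : ∀ s, φ s ≤ 1) :
    ∫⁻ s, φ s ∂reportLaw A x k hk ≤
      ∫⁻ s, φ s ∂reportLaw (clippedFamily A R) x k hk + k * (2 * τ) := by
  have hM : ∀ k x, IsMarkovKernel (clippedFamily A R k x) := fun k x =>
    isMarkovKernel_clippedKernel hR hR' x
  induction k with
  | zero => simp [reportLaw]
  | succ k ih =>
    have hk' : k < n := hk
    have : IsMarkovKernel (clippedFamily A R ⟨k, hk⟩ (x ⟨k, hk⟩) :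
      Kernel (ReportPrefix S k hk'.le) (S ⟨k, hk⟩)) := hM ⟨k, hk⟩ (x ⟨k, hk⟩)
    rw [lintegral_reportLaw_succ A x hk hφ, lintegral_reportLaw_succ _ x hk hφ,
      Measure.lintegral_compProd (by fun_prop), Measure.lintegral_compProd (by fun_prop)]
    -- Hybrid step: the last kernel is replaced under the true prefix law, then induction replaces
    -- the prefix. Since `totalLaw` dominates the prefix law of every dataset, one clipped family
    -- serves all datasets.
    have h1 := (reportLaw_ac_totalLaw A x k hk'.le).ae_le
      (lintegral_le_lintegral_clippedKernel_add (N := totalLaw A k hk'.le) hR hR'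
        (h ⟨k, hk⟩) (x ⟨k, hk⟩) (φ := fun p => φ (snocReport S hk p)) (by fun_prop)
        fun p => hφ1 _)
    have h2 := ih hk'.le (φ := fun s => ∫⁻ y, φ (snocReport S hk (s, y))
        ∂clippedFamily A R ⟨k, hk⟩ (x ⟨k, hk⟩) s)
      (Measurable.lintegral_kernel_prod_right' (f := fun p => φ (snocReport S hk p))
        (by fun_prop)) fun s => by
        calc _ ≤ ∫⁻ _, 1 ∂clippedFamily A R ⟨k, hk⟩ (x ⟨k, hk⟩) s := lintegral_mono fun y => hφ1 _
          _ = 1 := by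
            have := (hM ⟨k, hk⟩ (x ⟨k, hk⟩)).isProbabilityMeasure s
            simp
    calc _ ≤ ∫⁻ s, (∫⁻ y, φ (snocReport S hk (s, y)) ∂clippedFamily A R ⟨k, hk⟩ (x ⟨k, hk⟩) s +
            2 * τ) ∂reportLaw A x k hk'.le := lintegral_mono_ae h1
      _ = ∫⁻ s, ∫⁻ y, φ (snocReport S hk (s, y)) ∂clippedFamily A R ⟨k, hk⟩ (x ⟨k, hk⟩) s
            ∂reportLaw A x k hk'.le + 2 * τ := by
          rw [lintegral_add_right _ measurable_const]; simp
      _ ≤ _ := by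
          refine (add_le_add_left h2 _).trans_eq ?_
          push_cast
          ring

/-- Clipping yields the factor e^{4ε}, within the allowed e^{8ε}. -/
theorem isPureDPFamily_clippedFamily {ε : ℝ} (hε : 0 ≤ ε) :
    IsPureDPFamily (8 * ε) (clippedFamily A (ENNReal.ofReal (Real.exp ε))) := fun k s x x' => by
  have h1 : (1 : ENNReal) ≤ ENNReal.ofReal (Real.exp ε) := by
    rw [← ENNReal.ofReal_one]; exact ENNReal.ofReal_le_ofReal (Real.one_le_exp hε)
  refine (clippedKernel_le_smul h1 ENNReal.ofReal_ne_top x x' s).trans ?_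
  refine Measure.le_iff.2 fun E _ => ?_
  rw [Measure.smul_apply, Measure.smul_apply, smul_eq_mul, smul_eq_mul,
    ← ENNReal.ofReal_pow (Real.exp_nonneg _), ← Real.exp_nat_mul]
  gcongr
  · push_cast
    linarith
  · exact le_rfl

theorem abs_reportLaw_sub_clippedFamily_le {ε δ₀ : ℝ} (hε : 0 ≤ ε) (hδ₀ : 0 ≤ δ₀)
    (hA : IsLocalDPFamily ε δ₀ A) (x : Fin n → X) {E : Set (ReportPrefix S n le_rfl)}
    (hE : MeasurableSet E) :
    |(reportLaw A x n le_rfl).real E -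
      (reportLaw (clippedFamily A (ENNReal.ofReal (Real.exp ε))) x n le_rfl).real E| ≤
      n * (2 * δ₀) := by
  have h1 : (1 : ENNReal) ≤ ENNReal.ofReal (Real.exp ε) := by
    rw [← ENNReal.ofReal_one]; exact ENNReal.ofReal_le_ofReal (Real.one_le_exp hε)
  have hM : ∀ k x, IsMarkovKernel (clippedFamily A (ENNReal.ofReal (Real.exp ε)) k x) := fun k x =>
    isMarkovKernel_clippedKernel h1 ENNReal.ofReal_ne_top x
  have h : ∀ k s i j E, MeasurableSet E → A k i s E ≤
      ENNReal.ofReal (Real.exp ε) * A k j s E + ENNReal.ofReal δ₀ := fun k s i j E hE => by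
    have := hA k s i j E hE
    rw [← ENNReal.ofReal_toReal (measure_ne_top (A k i s) E),
      ← ENNReal.ofReal_toReal (measure_ne_top (A k j s) E), ← ENNReal.ofReal_mul (Real.exp_nonneg _),
      ← ENNReal.ofReal_add (by positivity) hδ₀]
    exact ENNReal.ofReal_le_ofReal this
  have key : ∀ F : Set (ReportPrefix S n le_rfl), MeasurableSet F →
      (reportLaw A x n le_rfl).real F ≤
      (reportLaw (clippedFamily A (ENNReal.ofReal (Real.exp ε))) x n le_rfl).real F +
        n * (2 * δ₀) := fun F hF => by
    have h2 := lintegral_reportLaw_le_clippedFamily h1 ENNReal.ofReal_ne_top h x n le_rfl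
      (measurable_one.indicator hF) fun s => Set.indicator_le_self' (by simp) s
    rw [lintegral_indicator_one hF, lintegral_indicator_one hF] at h2
    have hfin : (n : ENNReal) * (2 * ENNReal.ofReal δ₀) ≠ ⊤ :=
      ENNReal.mul_ne_top (by simp) (ENNReal.mul_ne_top (by simp) ENNReal.ofReal_ne_top)
    have h3 := ENNReal.toReal_mono (ENNReal.add_ne_top.2 ⟨measure_ne_top _ _, hfin⟩) h2
    rw [ENNReal.toReal_add (measure_ne_top _ _) hfin] at h3
    simpa [Measure.real, ENNReal.toReal_ofReal hδ₀] using h3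
  have h3 := key E hE
  have h4 := key Eᶜ hE.compl
  rw [probReal_compl_eq_one_sub hE, probReal_compl_eq_one_sub hE] at h4
  exact abs_le.2 ⟨by linarith, by linarith⟩

end ApproximateFamily

/-! ### Amplification for approximate randomizers -/

section ApproximateAmplification

variable {n : ℕ} [NeZero n] {X : Type*} {S : Fin n → Type*} [∀ k, MeasurableSpace (S k)]
  {A : AdaptiveRandomizers X S} [∀ k x, IsMarkovKernel (A k x)]

theorem abs_swapFixMechanism_sub_clippedFamily_le [Fintype X] [Nonempty X] {ε δ₀ : ℝ}
    (hε : 0 ≤ ε) (hδ₀ : 0 ≤ δ₀) (hA : IsLocalDPFamily ε δ₀ A) (ℓ : Fin n → ℕ) (D : Fin n → X)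
    {E : Set (∀ i : Fin n, ∀ k : Block ℓ i, S k.1)} (hE : MeasurableSet E) :
    |(swapFixMechanism A ℓ D).real E -
      (swapFixMechanism (clippedFamily A (ENNReal.ofReal (Real.exp ε))) ℓ D).real E| ≤
      n * (2 * δ₀) := by
  have h1 : (1 : ENNReal) ≤ ENNReal.ofReal (Real.exp ε) := by
    rw [← ENNReal.ofReal_one]; exact ENNReal.ofReal_le_ofReal (Real.one_le_exp hε)
  have hM : ∀ k x, IsMarkovKernel (clippedFamily A (ENNReal.ofReal (Real.exp ε)) k x) := fun k x =>
    isMarkovKernel_clippedKernel h1 ENNReal.ofReal_ne_top x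
  have hn : (n : ℝ) ≠ 0 := by exact_mod_cast NeZero.ne n
  rw [swapFixMechanism_real A ℓ D hE, swapFixMechanism_real _ ℓ D hE, ← mul_sub,
    ← Finset.sum_sub_distrib, abs_mul, abs_of_nonneg (by positivity)]
  calc _ ≤ (n : ℝ)⁻¹ * ∑ _I : Fin n, (n : ℝ) * (2 * δ₀) := by
        gcongr
        refine (Finset.abs_sum_le_sum_abs _ _).trans (Finset.sum_le_sum fun I _ => ?_)
        exact abs_reportLaw_sub_clippedFamily_le hε hδ₀ hA _ (measurable_blocks ℓ hE)
    _ = n * (2 * δ₀) := by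
        simp only [Finset.sum_const, Finset.card_univ, Fintype.card_fin, nsmul_eq_mul]
        field_simp

theorem isDPAtFirst_swapFixMechanism_of_fintype [Fintype X] [Nonempty X] (hn : 2 ≤ n) {ε δ₀ : ℝ}
    (hε : 0 ≤ ε) (hδ₀ : 0 ≤ δ₀) (hA : IsLocalDPFamily ε δ₀ A)
    (ℓ : Fin n → ℕ) {δ δ₁ δ₂ ε₁ : ℝ} (hδ : δ ∈ Set.Ioo (0 : ℝ) 1) (hδ₂ : δ₂ ∈ Set.Ioo (0 : ℝ) 1)
    (hε₁ : √((1 - 1 / (n : ℝ)) * (1 / n)) + √(Real.log (1 / δ₂) / n) ≤ ε₁) (hδ₁ : 2 * δ₀ ≤ δ₁) :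
    IsDPAtFirst (epsCentral (8 * ε) ε₁ δ)
      (δ + δ₂ + n * (Real.exp (epsCentral (8 * ε) ε₁ δ) + 1) * δ₁) (swapFixMechanism A ℓ) := by
  intro D D' hD E hE
  have h1 : (1 : ENNReal) ≤ ENNReal.ofReal (Real.exp ε) := by
    rw [← ENNReal.ofReal_one]; exact ENNReal.ofReal_le_ofReal (Real.one_le_exp hε)
  have hM : ∀ k x, IsMarkovKernel (clippedFamily A (ENNReal.ofReal (Real.exp ε)) k x) := fun k x =>
    isMarkovKernel_clippedKernel h1 ENNReal.ofReal_ne_top x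
  have h := isDPAtFirst_swapFixMechanism hn (by positivity)
    (isPureDPFamily_clippedFamily (A := A) hε) ℓ hδ hδ₂ hε₁ D D' hD E hE
  have hD1 := (abs_le.1 (abs_swapFixMechanism_sub_clippedFamily_le hε hδ₀ hA ℓ D hE)).2
  have hD2 := (abs_le.1 (abs_swapFixMechanism_sub_clippedFamily_le hε hδ₀ hA ℓ D' hE)).1
  have hτ : (n : ℝ) * (2 * δ₀) ≤ n * δ₁ := by gcongr
  set q := (swapFixMechanism (clippedFamily A (ENNReal.ofReal (Real.exp ε))) ℓ D').real E
  set w := Real.exp (epsCentral (8 * ε) ε₁ δ)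
  have h2 : w * q ≤ w * ((swapFixMechanism A ℓ D').real E + n * δ₁) := by
    gcongr; linarith
  linarith

theorem swapFixMechanism_comp {Y : Type*} (A : AdaptiveRandomizers X S) (e : Y → X)
    (ℓ : Fin n → ℕ) (z : Fin n → Y) :
    swapFixMechanism (fun k y => A k (e y)) ℓ z = swapFixMechanism A ℓ (e ∘ z) := by
  simp only [swapFixMechanism, fixMechanism]
  refine Finset.sum_congr rfl fun I _ => ?_
  rw [reportLaw_comp]
  rfl

/-- For δ₁ ≤ 1 both logarithms are nonnegative, so the denominator is at least 2, while the
numerator is at most δ₁. -/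
theorem two_mul_le_of_le_deltaZeroBound {ε₀ δ₀ δ₁ : ℝ} (hε₀ : 0 < ε₀) (hδ₁ : 0 < δ₁)
    (hδ₁' : δ₁ ≤ 1) (h : δ₀ ≤ deltaZeroBound ε₀ δ₁) : 2 * δ₀ ≤ δ₁ := by
  have hlog1 : 0 ≤ Real.log (2 / δ₁) := Real.log_nonneg (by rw [le_div_iff₀ hδ₁]; linarith)
  have he : Real.exp (-5 * ε₀) < 1 := Real.exp_lt_one_iff.2 (by linarith)
  have he' : Real.exp (-ε₀) < 1 := Real.exp_lt_one_iff.2 (by linarith)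
  have hlog2 : 0 ≤ Real.log (1 / (1 - Real.exp (-5 * ε₀))) := by
    refine Real.log_nonneg ?_
    rw [le_div_iff₀ (by linarith)]
    linarith [Real.exp_pos (-5 * ε₀)]
  have hden : 2 ≤ 4 * Real.exp ε₀ *
      (2 + Real.log (2 / δ₁) / Real.log (1 / (1 - Real.exp (-5 * ε₀)))) := by
    have h1 : 1 ≤ Real.exp ε₀ := Real.one_le_exp hε₀.le
    have h2 : 0 ≤ Real.log (2 / δ₁) / Real.log (1 / (1 - Real.exp (-5 * ε₀))) :=
      div_nonneg hlog1 hlog2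
    nlinarith
  have hb : deltaZeroBound ε₀ δ₁ ≤ δ₁ / 2 := by
    unfold deltaZeroBound
    have : (1 - Real.exp (-ε₀)) * δ₁ ≤ δ₁ :=
      mul_le_of_le_one_left hδ₁.le (by linarith [Real.exp_pos (-ε₀)])
    gcongr
  linarith

theorem isDPAtFirst_swapFixMechanism_of_le_deltaZeroBound (hn : 2 ≤ n) {ε₀ δ₀ : ℝ}
    (hε₀ : 0 < ε₀) (hδ₀ : 0 ≤ δ₀) (hA : IsLocalDPFamily ε₀ δ₀ A)
    (ℓ : Fin n → ℕ) {δ δ₁ δ₂ ε₁ : ℝ} (hδ : δ ∈ Set.Ioo (0 : ℝ) 1) (hδ₂ : δ₂ ∈ Set.Ioo (0 : ℝ) 1)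
    (hε₁ : √((1 - 1 / (n : ℝ)) * (1 / n)) + √(Real.log (1 / δ₂) / n) ≤ ε₁) (hδ₁ : 0 < δ₁)
    (hle : δ₀ ≤ deltaZeroBound ε₀ δ₁) :
    IsDPAtFirst (epsCentral (8 * ε₀) ε₁ δ)
      (δ + δ₂ + n * (Real.exp (epsCentral (8 * ε₀) ε₁ δ) + 1) * δ₁) (swapFixMechanism A ℓ) := by
  intro D D' hD E hE
  rcases le_or_gt δ₁ 1 with h1 | h1
  -- The symbols (i, true) and (i, false) stand for `D i` and `D' i`. The family pulled back along
  -- `e` has a finite alphabet, and the two datasets become words that differ only at position 0.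
  · let e : Fin n × Bool → X := fun j => if j.2 then D j.1 else D' j.1
    have hDe : D = e ∘ fun i => (i, true) := by funext i; simp [e]
    have hDe' : D' = e ∘ fun i => (i, decide (i ≠ 0)) := by
      funext i
      by_cases hi : i = 0
      · simp [e, hi]
      · simp [e, hi, hD i hi]
    have h := isDPAtFirst_swapFixMechanism_of_fintype (A := fun k j => A k (e j)) hn hε₀.le hδ₀
      (fun k s x x' => hA k s (e x) (e x')) ℓ hδ hδ₂ hε₁
      (two_mul_le_of_le_deltaZeroBound hε₀ hδ₁ h1 hle)
      (fun i => (i, true)) (fun i => (i, decide (i ≠ 0))) (fun i hi => by simp [hi]) E hE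
    rwa [swapFixMechanism_comp A e, swapFixMechanism_comp A e, ← hDe, ← hDe'] at h
  -- For δ₁ > 1 the additive term already exceeds one.
  · have hp : (swapFixMechanism A ℓ D).real E ≤ 1 := measureReal_le_one
    have hn1 : (1 : ℝ) ≤ n := by exact_mod_cast (by omega : 1 ≤ n)
    have h2 : 0 ≤ Real.exp (epsCentral (8 * ε₀) ε₁ δ) * (swapFixMechanism A ℓ D').real E := by
      positivity
    have h3 : (1 : ℝ) * 1 * 1 ≤ n * (Real.exp (epsCentral (8 * ε₀) ε₁ δ) + 1) * δ₁ := by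
      gcongr
      linarith [Real.exp_pos (epsCentral (8 * ε₀) ε₁ δ)]
    linarith [hδ.1, hδ₂.1]

end ApproximateAmplification

/-! ### Spectral bounds for the walk -/

theorem two_le_of_not_isBipartite {n : ℕ} {G : SimpleGraph (Fin n)} (hbip : ¬ G.IsBipartite) : 2 ≤ n := by
  by_contra hn
  have : Subsingleton (Fin n) := Fin.subsingleton_iff_le_one.2 (by omega)
  exact hbip ⟨SimpleGraph.Coloring.mk (fun _ => 0) fun {v w} h =>
    absurd (Subsingleton.elim v w) h.ne⟩

section Walk

variable {n : ℕ} {G : SimpleGraph (Fin n)} [DecidableRel G.Adj] {P₀ π : Fin n → ℝ}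

theorem walkDist_succ_apply (t : ℕ) (i : Fin n) :
    walkDist G P₀ (t + 1) i = ∑ j, G.adjMatrix ℝ i j * (walkDist G P₀ t j / G.degree j) := by
  rw [walkDist, pow_succ', ← Matrix.mulVec_mulVec]
  change ∑ j, (walkMatrix G)ᵀ i j * walkDist G P₀ t j = _
  refine Finset.sum_congr rfl fun j _ => ?_
  simp only [walkMatrix, Matrix.transpose_apply, Matrix.of_apply, SimpleGraph.adjMatrix_apply,
    G.adj_comm j i]
  ring

theorem walkDist_zero : walkDist G P₀ 0 = P₀ := by simp [walkDist]

theorem sum_adjMatrix_eq_degree (i : Fin n) : ∑ j, G.adjMatrix ℝ i j = G.degree i := by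
  simpa [Matrix.mulVec, dotProduct] using G.adjMatrix_mulVec_const_apply (α := ℝ) (a := 1) (v := i)

theorem sum_adjMatrix_mul (x : Fin n → ℝ) :
    ∑ i, ∑ j, G.adjMatrix ℝ i j * x j = ∑ j, G.degree j * x j := by
  rw [Finset.sum_comm]
  refine Finset.sum_congr rfl fun j _ => ?_
  rw [← Finset.sum_mul, ← sum_adjMatrix_eq_degree]
  simp only [SimpleGraph.adjMatrix_apply, G.adj_comm j]

theorem sum_walkDist (hdeg : ∀ i, 0 < G.degree i) (hP₀ : P₀ ∈ stdSimplex ℝ (Fin n)) (t : ℕ) :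
    ∑ i, walkDist G P₀ t i = 1 := by
  induction t with
  | zero => rw [walkDist_zero]; exact hP₀.2
  | succ t ih =>
    simp_rw [walkDist_succ_apply]
    rw [sum_adjMatrix_mul, ← ih]
    refine Finset.sum_congr rfl fun j _ => ?_
    have : (G.degree j : ℝ) ≠ 0 := by exact_mod_cast (hdeg j).ne'
    field_simp

/-- Stationarity says that the Laplacian annihilates π / deg, which is therefore constant on a
connected graph. The constant is positive because π sums to one. -/
theorem IsStationaryDist.exists_eq_mul_degree (hconn : G.Connected) (hdeg : ∀ i, 0 < G.degree i)
    (hπ : IsStationaryDist G π) : ∃ K : ℝ, 0 < K ∧ ∀ i, π i = K * G.degree i := by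
  have hd : ∀ i, (G.degree i : ℝ) ≠ 0 := fun i => by exact_mod_cast (hdeg i).ne'
  have hstat : ∀ i, π i = ∑ j, G.adjMatrix ℝ i j * (π j / G.degree j) := fun i => by
    conv_lhs => rw [hπ.2]
    have := walkDist_succ_apply (G := G) (P₀ := π) 0 i
    rwa [walkDist_zero, walkDist, zero_add, pow_one] at this
  have hharm : G.lapMatrix ℝ *ᵥ (fun i => π i / G.degree i) = 0 := by
    funext i
    rw [SimpleGraph.lapMatrix, Matrix.sub_mulVec, Pi.sub_apply, SimpleGraph.degMatrix,
      Matrix.mulVec_diagonal, mul_div_cancel₀ _ (hd i), Pi.zero_apply, sub_eq_zero]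
    exact hstat i
  have hconst := (SimpleGraph.lapMatrix_mulVec_eq_zero_iff_forall_reachable G).1 hharm
  obtain ⟨i₀⟩ := hconn.nonempty
  have hall : ∀ i, π i = π i₀ / G.degree i₀ * G.degree i := fun i => by
    rw [← hconst i i₀ (hconn.preconnected i i₀), div_mul_cancel₀ _ (hd i)]
  refine ⟨π i₀ / G.degree i₀, ?_, hall⟩
  refine (div_nonneg (hπ.1.1 i₀) (by positivity)).lt_of_ne fun h0 => ?_
  have h1 := hπ.1.2
  rw [Finset.sum_eq_zero fun i _ => by rw [hall i, ← h0, zero_mul]] at h1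
  exact zero_ne_one h1

/-- For a unit eigenvector, 2ab ≤ a² + b² with a = vᵢ/√dᵢ and b = vⱼ/√dⱼ, summed over adjacent
pairs, bounds the quadratic form by Σ vᵢ² = 1. -/
theorem normAdjMatrix_eigenvalues_le_one (hdeg : ∀ i, 0 < G.degree i) (k : Fin n) :
    (normAdjMatrix_isHermitian G).eigenvalues k ≤ 1 := by
  have hd : ∀ i, (0 : ℝ) < G.degree i := fun i => by exact_mod_cast hdeg i
  set hS := normAdjMatrix_isHermitian G
  set v : Fin n → ℝ := ⇑(hS.eigenvectorBasis k) with hv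
  have hnorm : ∑ i, v i ^ 2 = 1 := by
    have := hS.eigenvectorBasis.norm_eq_one k
    rw [EuclideanSpace.norm_eq, Real.sqrt_eq_one] at this
    simpa using this
  have heig : ∀ i, ∑ j, normAdjMatrix G i j * v j = hS.eigenvalues k * v i := fun i =>
    congrFun (hS.mulVec_eigenvectorBasis k) i
  have hquad : ∑ i, ∑ j, v i * (normAdjMatrix G i j * v j) = hS.eigenvalues k := by
    simp_rw [← Finset.mul_sum, heig]
    calc ∑ i, v i * (hS.eigenvalues k * v i) = hS.eigenvalues k * ∑ i, v i ^ 2 := by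
          rw [Finset.mul_sum]; exact Finset.sum_congr rfl fun i _ => by ring
      _ = _ := by rw [hnorm, mul_one]
  have hterm : ∀ i j, v i * (normAdjMatrix G i j * v j) ≤
      (G.adjMatrix ℝ i j * (v i ^ 2 / G.degree i) + G.adjMatrix ℝ i j * (v j ^ 2 / G.degree j)) / 2 :=
    fun i j => by
    have hA : 0 ≤ G.adjMatrix ℝ i j := by
      rw [SimpleGraph.adjMatrix_apply]; split_ifs <;> norm_num
    have h1 : v i * (normAdjMatrix G i j * v j) =
        G.adjMatrix ℝ i j * ((v i / √(G.degree i)) * (v j / √(G.degree j))) := by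
      simp only [normAdjMatrix, Matrix.of_apply]
      field_simp
    have h2 : ∀ i, (v i / √(G.degree i)) ^ 2 = v i ^ 2 / G.degree i := fun i => by
      rw [div_pow, Real.sq_sqrt (hd i).le]
    rw [h1, ← h2, ← h2, ← mul_add, mul_div_assoc]
    refine mul_le_mul_of_nonneg_left ?_ hA
    linarith [two_mul_le_add_sq (v i / √(G.degree i)) (v j / √(G.degree j))]
  rw [← hquad]
  calc _ ≤ ∑ i, ∑ j, (G.adjMatrix ℝ i j * (v i ^ 2 / G.degree i) +
          G.adjMatrix ℝ i j * (v j ^ 2 / G.degree j)) / 2 :=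
        Finset.sum_le_sum fun i _ => Finset.sum_le_sum fun j _ => hterm i j
    _ = ((∑ i, ∑ j, G.adjMatrix ℝ i j * (v i ^ 2 / G.degree i)) +
          ∑ i, ∑ j, G.adjMatrix ℝ i j * (v j ^ 2 / G.degree j)) / 2 := by
        simp_rw [← Finset.sum_div, Finset.sum_add_distrib]
    _ = 1 := by
        rw [sum_adjMatrix_mul]
        simp_rw [← Finset.sum_mul, sum_adjMatrix_eq_degree]
        simp_rw [fun i => mul_div_cancel₀ (v i ^ 2) (hd i).ne', hnorm]
        norm_num

/-- A symmetric matrix acts diagonally on coefficients in its eigenbasis. -/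
theorem inner_eigenvectorBasis_mulVec {S : Matrix (Fin n) (Fin n) ℝ} (hS : S.IsHermitian)
    (k : Fin n) (x : Fin n → ℝ) :
    inner ℝ (hS.eigenvectorBasis k) (WithLp.toLp 2 (S *ᵥ x)) =
      hS.eigenvalues k * inner ℝ (hS.eigenvectorBasis k) (WithLp.toLp 2 x) := by
  have h1 : ∀ y : Fin n → ℝ, inner ℝ (hS.eigenvectorBasis k) (WithLp.toLp 2 y) =
      y ⬝ᵥ ⇑(hS.eigenvectorBasis k) := fun y => by
    simp [PiLp.inner_apply, dotProduct]
  have hsym : Sᵀ = S := by rw [← Matrix.conjTranspose_eq_transpose_of_trivial]; exact hS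
  rw [h1, h1, dotProduct_comm, Matrix.dotProduct_mulVec, ← Matrix.mulVec_transpose, hsym,
    hS.mulVec_eigenvectorBasis, smul_dotProduct, smul_eq_mul, dotProduct_comm]

/-- Powers of a symmetric matrix contract, up to the component along a fixed unit vector. -/
theorem sum_eigenvalue_pow_mul_sq_le {ι : Type*} [Fintype ι] [DecidableEq ι] {lam c f : ι → ℝ}
    {i₀ : ι} {ρ : ℝ} (hle : ∀ i, i ≠ i₀ → |lam i| ≤ ρ)
    (hρ : |lam i₀| ≤ ρ ∨ ∀ i, i ≠ i₀ → lam i < 1)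
    (hf : ∀ i, lam i * f i = f i) (hff : ∑ i, f i ^ 2 = 1) (hfc : ∑ i, f i * c i = 1) (t : ℕ) :
    ∑ i, (lam i ^ t * c i) ^ 2 ≤ 1 + ρ ^ (2 * t) * ∑ i, c i ^ 2 := by
  have hterm : ∀ i, |lam i| ≤ ρ → (lam i ^ t * c i) ^ 2 ≤ ρ ^ (2 * t) * c i ^ 2 := fun i hi => by
    rw [mul_pow, ← pow_mul, mul_comm t 2, pow_mul, ← sq_abs, ← pow_mul]
    gcongr
  rcases hρ with hρ | hρ
  · rw [Finset.mul_sum]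
    refine le_add_of_nonneg_of_le zero_le_one (Finset.sum_le_sum fun i _ => hterm i ?_)
    by_cases hi : i = i₀
    · rwa [hi]
    · exact hle i hi
  -- A fixed vector has no component where the eigenvalue is below 1, so `f` is concentrated at
  -- `i₀`. Hence `lam i₀ = 1` and `c i₀ ^ 2 = 1`, which is the leading 1 in the bound.
  · have hf0 : ∀ i, i ≠ i₀ → f i = 0 := fun i hi => by
      by_contra hne
      exact (hρ i hi).ne (mul_right_cancel₀ hne (by rw [hf i, one_mul]))
    rw [Finset.sum_eq_single i₀ (fun i _ hi => by rw [hf0 i hi]; ring) (by simp)] at hff hfc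
    have hfne : f i₀ ≠ 0 := fun h => by simp [h] at hff
    have hlam1 : lam i₀ = 1 := mul_right_cancel₀ hfne (by rw [hf i₀, one_mul])
    have hc1 : c i₀ ^ 2 = 1 := by
      have : (f i₀ * c i₀) ^ 2 = 1 := by rw [hfc, one_pow]
      rwa [mul_pow, hff, one_mul] at this
    rw [← Finset.add_sum_erase _ _ (Finset.mem_univ i₀), hlam1, one_pow, one_mul, hc1]
    gcongr
    rw [Finset.mul_sum]
    calc _ ≤ ∑ i ∈ Finset.univ.erase i₀, ρ ^ (2 * t) * c i ^ 2 :=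
          Finset.sum_le_sum fun i hi => hterm i (hle i (Finset.ne_of_mem_erase hi))
      _ ≤ _ := Finset.sum_le_sum_of_subset_of_nonneg (Finset.erase_subset _ _) fun i _ _ =>
          mul_nonneg (by rw [pow_mul]; positivity) (sq_nonneg _)

theorem exists_walkEigenvalue_reindex [NeZero n] (hn : 2 ≤ n) (G : SimpleGraph (Fin n))
    [DecidableRel G.Adj] : ∃ i₀ : Fin n,
      (normAdjMatrix_isHermitian G).eigenvalues i₀ = walkEigenvalue G 0 ∧
      (∀ i, walkEigenvalue G (Fin.rev 0) ≤ (normAdjMatrix_isHermitian G).eigenvalues i) ∧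
      ∀ i, i ≠ i₀ → (normAdjMatrix_isHermitian G).eigenvalues i ≤ walkEigenvalue G 1 := by
  let e : Fin n ≃ Fin (Fintype.card (Fin n)) :=
    (Fintype.equivOfCardEq (Fintype.card_fin _)).symm
  have he : ∀ i, (normAdjMatrix_isHermitian G).eigenvalues i =
    walkEigenvalue G (Fin.cast (Fintype.card_fin n) (e i)) := fun i => rfl
  have hanti : Antitone (walkEigenvalue G) := fun i j hij =>
    (normAdjMatrix_isHermitian G).eigenvalues₀_antitone hij
  refine ⟨e.symm (Fin.cast (Fintype.card_fin n).symm 0), ?_, fun i => ?_, fun i hi => ?_⟩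
  · rw [he]; simp
  · rw [he]
    refine hanti ?_
    rw [Fin.le_def, Fin.val_rev]
    simp only [Fin.val_cast, Fin.val_zero]
    have := (Fin.cast (Fintype.card_fin n) (e i)).isLt
    simp only [Fin.val_cast] at this
    omega
  · rw [he]
    refine hanti ?_
    have h0 : (Fin.cast (Fintype.card_fin n) (e i)) ≠ 0 := fun h => hi <| by
      rw [Equiv.eq_symm_apply, ← h]; simp
    -- The literal `1 : Fin n` differs from `0` only when n ≥ 2.
    obtain ⟨m, rfl⟩ : ∃ m, n = m + 2 := ⟨n - 2, by omega⟩
    exact Fin.one_le_of_ne_zero h0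

/-- The collision probability relative to the stationary distribution. -/
theorem sum_walkDist_sq_div_le [NeZero n] (hn : 2 ≤ n) (hconn : G.Connected)
    (hdeg : ∀ i, 0 < G.degree i) (hP₀ : P₀ ∈ stdSimplex ℝ (Fin n)) (hπ : IsStationaryDist G π)
    (t : ℕ) :
    ∑ i, walkDist G P₀ t i ^ 2 / π i ≤
      1 + (1 - walkSpectralGap G) ^ (2 * t) * ∑ i, P₀ i ^ 2 / π i := by
  obtain ⟨K, hK, hπK⟩ := hπ.exists_eq_mul_degree hconn hdeg
  have hd : ∀ i, (0 : ℝ) < G.degree i := fun i => by exact_mod_cast hdeg i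
  have hπ0 : ∀ i, 0 < π i := fun i => by rw [hπK]; exact mul_pos hK (hd i)
  have hsqrt : ∀ i, √(π i) = √K * √(G.degree i) := fun i => by rw [hπK, Real.sqrt_mul hK.le]
  set hS := normAdjMatrix_isHermitian G
  -- In these coordinates a step of the walk is `normAdjMatrix G`, the weighted collision
  -- probability is ‖v t‖², and `φ` is a fixed unit vector with ⟨φ, v 0⟩ = 1.
  let v : ℕ → Fin n → ℝ := fun t i => walkDist G P₀ t i / √(π i)
  let φ : Fin n → ℝ := fun i => √(π i)
  have hv : ∀ t, normAdjMatrix G *ᵥ v t = v (t + 1) := fun t => funext fun i => by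
    change ∑ j, normAdjMatrix G i j * (walkDist G P₀ t j / √(π j)) = _ / √(π i)
    rw [walkDist_succ_apply, Finset.sum_div]
    refine Finset.sum_congr rfl fun j _ => ?_
    rw [hsqrt, hsqrt, normAdjMatrix, Matrix.of_apply]
    conv_rhs => rw [← Real.mul_self_sqrt (hd j).le]
    field_simp
  have hφ : normAdjMatrix G *ᵥ φ = φ := funext fun i => by
    change ∑ j, normAdjMatrix G i j * √(π j) = √(π i)
    have h1 : ∀ j, normAdjMatrix G i j * √(π j) = G.adjMatrix ℝ i j * (√K / √(G.degree i)) :=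
      fun j => by
      have := Real.sqrt_pos.2 (hd j)
      rw [hsqrt, normAdjMatrix, Matrix.of_apply]
      field_simp
    simp_rw [h1]
    rw [← Finset.sum_mul, sum_adjMatrix_eq_degree, hsqrt]
    rw [mul_div_assoc', div_eq_iff (Real.sqrt_pos.2 (hd i)).ne', mul_comm (G.degree i : ℝ),
      mul_assoc, Real.mul_self_sqrt (hd i).le]
  let coef : (Fin n → ℝ) → Fin n → ℝ := fun x k =>
    inner ℝ (hS.eigenvectorBasis k) (WithLp.toLp 2 x)
  have hparseval : ∀ x y : Fin n → ℝ, ∑ k, coef x k * coef y k = ∑ i, x i * y i := fun x y => by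
    have := hS.eigenvectorBasis.sum_inner_mul_inner (WithLp.toLp 2 x) (WithLp.toLp 2 y)
    simp only [PiLp.inner_apply (WithLp.toLp 2 x) (WithLp.toLp 2 y)] at this
    calc _ = ∑ k, inner ℝ (WithLp.toLp 2 x) (hS.eigenvectorBasis k) *
          inner ℝ (hS.eigenvectorBasis k) (WithLp.toLp 2 y) :=
          Finset.sum_congr rfl fun k _ => by rw [real_inner_comm]
      _ = _ := this
      _ = _ := Finset.sum_congr rfl fun i _ => by simp [mul_comm]
  have hparseval_sq : ∀ x : Fin n → ℝ, ∑ k, coef x k ^ 2 = ∑ i, x i ^ 2 := fun x => by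
    simpa only [sq] using hparseval x x
  have hcoef : ∀ t k, coef (v t) k = hS.eigenvalues k ^ t * coef (v 0) k := fun t k => by
    induction t with
    | zero => simp
    | succ t ih =>
      rw [← hv, pow_succ', mul_assoc, ← ih]
      exact inner_eigenvectorBasis_mulVec hS k (v t)
  have hvsq : ∀ t, ∑ k, coef (v t) k ^ 2 = ∑ i, walkDist G P₀ t i ^ 2 / π i := fun t => by
    rw [hparseval_sq]
    refine Finset.sum_congr rfl fun i _ => ?_
    rw [div_pow, Real.sq_sqrt (hπ0 i).le]
  obtain ⟨i₀, hi₀, hlow, hup⟩ := exists_walkEigenvalue_reindex hn G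
  have hgap : 1 - walkSpectralGap G =
      max (walkEigenvalue G 1) |walkEigenvalue G (Fin.rev 0)| := by
    rw [walkSpectralGap, min_sub_sub_left, sub_sub_cancel]
  have habs : ∀ i, hS.eigenvalues i ≤ walkEigenvalue G 1 →
      |hS.eigenvalues i| ≤ 1 - walkSpectralGap G := fun i hi => by
    rw [hgap]
    refine abs_le.2 ⟨?_, hi.trans (le_max_left _ _)⟩
    have h1 := neg_abs_le (walkEigenvalue G (Fin.rev 0))
    have h2 := le_max_right (walkEigenvalue G 1) |walkEigenvalue G (Fin.rev 0)|
    linarith [hlow i]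
  have h := sum_eigenvalue_pow_mul_sq_le (lam := hS.eigenvalues) (c := coef (v 0)) (f := coef φ)
    (i₀ := i₀) (ρ := 1 - walkSpectralGap G)
    (fun i hi => habs i (hup i hi)) ?_ (fun k => ?_) ?_ ?_ t
  · simp_rw [← hcoef] at h
    rwa [hvsq, hvsq, walkDist_zero] at h
  -- If α₂ ≥ 1, then 1 - α ≥ 1 bounds every eigenvalue in absolute value; otherwise the top
  -- eigenvalue is separated from the rest. So simplicity of the eigenvalue 1 need not be proved.
  · rcases le_or_gt 1 (walkEigenvalue G 1) with h1 | h1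
    · exact Or.inl (habs i₀ ((normAdjMatrix_eigenvalues_le_one hdeg i₀).trans h1))
    · exact Or.inr fun i hi => (hup i hi).trans_lt h1
  · have := inner_eigenvectorBasis_mulVec hS k φ
    rw [hφ] at this
    exact this.symm
  · rw [hparseval_sq, ← hπ.1.2]
    exact Finset.sum_congr rfl fun i _ => Real.sq_sqrt (hπ0 i).le
  · rw [hparseval, ← hP₀.2]
    refine Finset.sum_congr rfl fun i _ => ?_
    change √(π i) * (walkDist G P₀ 0 i / √(π i)) = _
    rw [mul_div_cancel₀ _ (Real.sqrt_pos.2 (hπ0 i)).ne', walkDist_zero]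

/-- On a regular graph π is uniform; the weighted bound divided by n, together with Σ P₀(i)² ≤ 1,
gives the claim. -/
theorem sum_walkDist_sq_le_of_isRegular [NeZero n] (hn : 2 ≤ n) (hconn : G.Connected)
    (hdeg : ∀ i, 0 < G.degree i) (hP₀ : P₀ ∈ stdSimplex ℝ (Fin n)) (hπ : IsStationaryDist G π)
    (t : ℕ) {d : ℕ} (hd : G.IsRegularOfDegree d) :
    ∑ i, walkDist G P₀ t i ^ 2 ≤ ∑ i, π i ^ 2 + (1 - walkSpectralGap G) ^ (2 * t) := by
  obtain ⟨K, hK, hπK⟩ := hπ.exists_eq_mul_degree hconn hdeg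
  have hn0 : (0 : ℝ) < n := by exact_mod_cast NeZero.pos n
  have hconst : ∀ i, π i = 1 / n := by
    have h1 : ∀ i, π i = K * d := fun i => by rw [hπK, hd i]
    have h2 := hπ.1.2
    simp only [h1, Finset.sum_const, Finset.card_univ, Fintype.card_fin, nsmul_eq_mul] at h2
    intro i
    rw [h1, eq_div_iff hn0.ne', mul_comm, h2]
  have h := sum_walkDist_sq_div_le hn hconn hdeg hP₀ hπ t
  simp_rw [hconst, ← Finset.sum_div] at h ⊢
  have hP : ∑ i, P₀ i ^ 2 ≤ 1 := by
    rw [← hP₀.2]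
    refine Finset.sum_le_sum fun i _ => ?_
    have h1 : P₀ i ≤ 1 := by
      rw [← hP₀.2]; exact Finset.single_le_sum (fun j _ => hP₀.1 j) (Finset.mem_univ i)
    nlinarith [hP₀.1 i]
  have hρ : 0 ≤ (1 - walkSpectralGap G) ^ (2 * t) := by rw [pow_mul]; positivity
  have hsum : ∑ _i : Fin n, (1 / (n : ℝ)) ^ 2 = 1 / (n : ℝ) := by
    simp only [Finset.sum_const, Finset.card_univ, Fintype.card_fin, nsmul_eq_mul]
    field_simp
  rw [hsum]
  rw [div_div_eq_mul_div, div_div_eq_mul_div, div_one, div_one] at h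
  have h2 : (1 - walkSpectralGap G) ^ (2 * t) * ((∑ i, P₀ i ^ 2) * n) ≤
      (1 - walkSpectralGap G) ^ (2 * t) * (1 * n) := by gcongr
  rw [← mul_le_mul_iff_left₀ hn0, add_mul, one_div_mul_cancel hn0.ne']
  linarith

theorem one_div_le_sum_sq {x : Fin n → ℝ} (hx : ∑ i, x i = 1) : 1 / (n : ℝ) ≤ ∑ i, x i ^ 2 := by
  have h := sq_sum_le_card_mul_sum_sq (s := Finset.univ) (f := x)
  rw [hx, one_pow, Finset.card_univ, Fintype.card_fin] at h
  exact div_le_of_le_mul₀ (by positivity) (Finset.sum_nonneg fun i _ => sq_nonneg _)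
    (by linarith)

end Walk

/-! ### Assembly: collision probabilities and privacy -/

theorem mainTheorem5 {n : ℕ} [NeZero n] {X : Type*} {S : Fin n → Type*}
    [∀ k, MeasurableSpace (S k)]
    (A : AdaptiveRandomizers X S) [∀ k x, IsMarkovKernel (A k x)]
    (ℓ : Fin n → ℕ) (hℓ : ∑ i, ℓ i = n)
    (G : SimpleGraph (Fin n)) [DecidableRel G.Adj] (hconn : G.Connected) (hbip : ¬ G.IsBipartite)
    (P₀ : Fin n → ℝ) (hP₀ : P₀ ∈ stdSimplex ℝ (Fin n))
    (π : Fin n → ℝ) (hπ : IsStationaryDist G π) (t : ℕ)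
    (ε₀ δ δ₂ : ℝ) (hε₀ : 0 ≤ ε₀) (hδ : δ ∈ Set.Ioo (0 : ℝ) 1) (hδ₂ : δ₂ ∈ Set.Ioo (0 : ℝ) 1) :
    -- privacy, with `ε₁` evaluated at the collision probability of the walk at time `t`,
    -- or at its spectral bound
    (∀ q : ℝ,
      (q = ∑ i, walkDist G P₀ t i ^ 2 ∨
        q = ∑ i, π i ^ 2 + (1 - walkSpectralGap G) ^ (2 * t)) →
      (IsLocalDPFamily ε₀ 0 A →
        IsDPAtFirst (epsCentral ε₀ (epsOne n q δ₂) δ) (δ + δ₂) (swapFixMechanism A ℓ)) ∧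
      (∀ δ₀ δ₁ : ℝ, 0 < ε₀ → 0 ≤ δ₀ → 0 < δ₁ → δ₀ ≤ deltaZeroBound ε₀ δ₁ →
        IsLocalDPFamily ε₀ δ₀ A →
        IsDPAtFirst (epsCentral (8 * ε₀) (epsOne n q δ₂) δ)
          (δ + δ₂ + n * (Real.exp (epsCentral (8 * ε₀) (epsOne n q δ₂) δ) + 1) * δ₁)
          (swapFixMechanism A ℓ))) ∧
    -- the spectral bound on the collision probability for regular graphs,
    -- and its weighted form for all graphs
    (∀ d : ℕ, G.IsRegularOfDegree d →
      ∑ i, walkDist G P₀ t i ^ 2 ≤ ∑ i, π i ^ 2 + (1 - walkSpectralGap G) ^ (2 * t)) ∧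
    ∑ i, walkDist G P₀ t i ^ 2 / π i ≤
      1 + (1 - walkSpectralGap G) ^ (2 * t) * ∑ i, P₀ i ^ 2 / π i := by
  have hn : 2 ≤ n := two_le_of_not_isBipartite hbip
  have : Nontrivial (Fin n) := Fin.nontrivial_iff_two_le.2 hn
  have hdeg : ∀ i, 0 < G.degree i := fun i => hconn.preconnected.degree_pos_of_nontrivial i
  have hn1 : 0 ≤ 1 - 1 / (n : ℝ) := by
    rw [sub_nonneg, div_le_one (by positivity)]
    exact_mod_cast (by omega : 1 ≤ n)
  refine ⟨fun q hq => ?_, fun d hd => sum_walkDist_sq_le_of_isRegular hn hconn hdeg hP₀ hπ t hd,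
    sum_walkDist_sq_div_le hn hconn hdeg hP₀ hπ t⟩
  have hq1 : 1 / (n : ℝ) ≤ q := by
    rcases hq with rfl | rfl
    · exact one_div_le_sum_sq (sum_walkDist hdeg hP₀ t)
    · refine (one_div_le_sum_sq hπ.1.2).trans (le_add_of_nonneg_right ?_)
      rw [pow_mul]
      positivity
  -- `epsOne` is monotone in q, so the smallest possible value q = 1/n is the one the amplification
  -- lemmas need.
  have hε₁ : √((1 - 1 / (n : ℝ)) * (1 / n)) + √(Real.log (1 / δ₂) / n) ≤ epsOne n q δ₂ := by
    unfold epsOne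
    gcongr
  exact ⟨fun hA => isDPAtFirst_swapFixMechanism hn hε₀ hA.isPureDPFamily ℓ hδ hδ₂ hε₁,
    fun δ₀ δ₁ hε₀' hδ₀ hδ₁ hle hA =>
      isDPAtFirst_swapFixMechanism_of_le_deltaZeroBound hn hε₀' hδ₀ hA ℓ hδ hδ₂ hε₁ hδ₁ hle⟩
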